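/- **Setting.** Let $(\mathsf X,\mathcal X)$ and $(\mathsf U,\mathcal U)$ be measurable spaces, $\pi$ a probability distribution on $\mathsf X$, $q$ a Markov kernel on $\mathsf X$, $(Q_{x,y})_{x,y\in\mathsf X}$ a Markov kernel from $\mathsf X^2$ to $\mathsf U$, and $\varphi:\mathsf U\to\mathsf U$ a measurable involution; put $\bar Q_{x,y}(A)=Q_{x,y}(\varphi(A))$ for $A\in\mathcal U$. A ratio $m_2(\mathrm dz)/m_1(\mathrm dz)$ of two finite measures means $\eta_2(z)/\eta_1(z)$, with $\eta_i=\mathrm dm_i/\mathrm d(m_1+m_2)$, at the points where $\eta_1,\eta_2>0$, and $0$ elsewhere. Let $$r(x,y)=\frac{\pi(\mathrm dy)q(y,\mathrm dx)}{\pi(\mathrm dx)q(x,\mathrm dy)},\qquad \mathring r_u(x,y)=\frac{\pi(\mathrm dy)q(y,\mathrm dx)\bar Q_{y,x}(\mathrm du)}{\pi(\mathrm dx)q(x,\mathrm dy)Q_{x,y}(\mathrm du)},\qquad \mathring r^N_{\mathfrak u}(x,y)=\frac1N\sum_{i=1}^N\mathring r_{u^{(i)}}(x,y)$$ for $\mathfrak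 u=(u^{(1)},\dots,u^{(N)})\in\mathsf U^N$. The Metropolis–Hastings kernel $P$ moves from $x$ to $y\sim q(x,\cdot)$ with probability $\min\{1,r(x,y)\}$, and otherwise stays at $x$. For $N\ge1$ the kernel $\mathring P^N$ uses, with probability $1/2$ each, one of two mechanisms from $x$: * ($Q_1^N$) draw $y\sim q(x,\cdot)$, then $u^{(1)},\dots,u^{(N)}$ i.i.d. from $Q_{x,y}$, then $k\in\{1,\dots,N\}$ with probability proportional to $\mathring r_{u^{(k)}}(x,y)$ (uniformly if these weights are all zero); move to $y$ with probability $\min\{1,\mathring r^N_{\mathfrak u}(x,y)\}$, otherwise stay at $x$; * ($Q_2^N$) draw $y\sim q(x,\cdot)$, then $k$ uniform on $\{1,\dots,N\}$, then independently $u^{(k)}\sim\bar Q_{x,y}$ and $u^{(i)}\sim Q_{y,x}$ for $i\ne k$; move to $y$ with probability $\min\{1,1/\mathring r^N_{\mathfrak u}(y,x)\}$ if $\mathring r_{u^{(k)}}(y,x)>0$, and with probability $0$ otherwise; if not moving, stay at $x$. For a $\pi$-reversible Markov kernel $\Pi$ and $f\in L^2(\mathsf X,\pi)$, let $(X_i)_{i\ge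 1}$ be the Markov chain with transition kernel $\Pi$ and $X_1\sim\pi$, and let $$\mathcal E_\Pi(f)=\tfrac12\int\pi(\mathrm dx)\Pi(x,\mathrm dy)\,(f(x)-f(y))^2,\qquad \mathsf{var}(f,\Pi)=\lim_{M\to\infty}\mathsf{var}\Big(M^{-1/2}\sum_{i=1}^Mf(X_i)\Big)\in[0,\infty],$$ $$\mathrm{Gap}_R(\Pi)=\inf\{\mathcal E_\Pi(f): f\in L^2(\mathsf X,\pi),\ \mathbb E_\pi(f)=0,\ \mathsf{var}_\pi(f)=1\}\qquad(\inf\emptyset=\infty).$$ **Theorem.** 1. For every $N\ge1$, $\mathring P^N$ is $\pi$-reversible. 2. For every $N\ge1$, $\mathrm{Gap}_R(\mathring P^N)\le\mathrm{Gap}_R(P)$, and $N\mapsto\mathrm{Gap}_R(\mathring P^N)$ is non-decreasing. 3. For every $f\in L^2(\mathsf X,\pi)$: (a) $N\mapsto\mathcal E_{\mathring P^N}(f)$ is non-decreasing, and the first-order auto-covariance $\mathrm{Cov}(f(X_1),f(X_2))$ of the chain with kernel $\mathring P^N$ started from $\pi$ is non-increasing in $N$; (b) the limits $\mathsf{var}(f,\mathring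 P^N)$ and $\mathsf{var}(f,P)$ exist in $[0,\infty]$, and $N\mapsto\mathsf{var}(f,\mathring P^N)$ is non-increasing; (c) $\mathsf{var}(f,\mathring P^N)\ge\mathsf{var}(f,P)$ for every $N\ge1$. -/

import Mathlib

open MeasureTheory ProbabilityTheory Filter Topology
open scoped ENNReal

noncomputable section

namespace MHAAR

/-! ### Performance measures of a Markov kernel -/

section Performance

variable {E : Type*} [MeasurableSpace E]

/-- The law on `ℕ → E` of the Markov chain with initial distribution `μ` and transition kernel `κ`:
coordinate `0` has law `μ`, and coordinate `n + 1` is drawn from `κ` started at coordinate `n`. -/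
def chainLaw (μ : Measure E) (κ : Kernel E E) [IsMarkovKernel κ] : Measure (ℕ → E) :=
  Kernel.trajMeasure (X := fun _ => E) μ
    (fun n => κ.comap (fun h : (Finset.Iic n → E) => h ⟨n, Finset.mem_Iic.2 le_rfl⟩)
      (measurable_pi_apply _))

/-- The variance of `M ^ (-1/2) * (f X₁ + ⋯ + f X_M)` for the chain started from `μ`
(`X_{i+1}` is the `i`-th coordinate), as a number in `[0, ∞]`. -/
def scaledVariance (μ : Measure E) (κ : Kernel E E) [IsMarkovKernel κ] (f : E → ℝ) (M : ℕ) :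
    ℝ≥0∞ :=
  evariance (fun ω : ℕ → E => (Real.sqrt M)⁻¹ * ∑ i ∈ Finset.range M, f (ω i)) (chainLaw μ κ)

/-- The asymptotic variance, the limit of `scaledVariance` in `[0, ∞]`. -/
def asymVar (μ : Measure E) (κ : Kernel E E) [IsMarkovKernel κ] (f : E → ℝ) : ℝ≥0∞ :=
  limUnder atTop (scaledVariance μ κ f)

/-- The first order auto-covariance of `f` along the chain started from `μ`. -/
def autoCov (μ : Measure E) (κ : Kernel E E) [IsMarkovKernel κ] (f : E → ℝ) : ℝ :=
  covariance (fun ω : ℕ → E => f (ω 0)) (fun ω : ℕ → E => f (ω 1)) (chainLaw μ κ)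

/-- The Dirichlet form `½ ∫ μ(dx) κ(x, dy) (f x - f y)²`. -/
def dirichletForm (μ : Measure E) (κ : Kernel E E) (f : E → ℝ) : ℝ≥0∞ :=
  2⁻¹ * ∫⁻ z : E × E, ENNReal.ofReal ((f z.1 - f z.2) ^ 2) ∂(μ ⊗ₘ κ)

/-- The right spectral gap: the infimum of the Dirichlet form over the centred functions of
`L²(μ)` with unit variance (`∞` if there is none, that is, if `L²(μ)` contains only constants). -/
def rightGap (μ : Measure E) (κ : Kernel E E) : ℝ≥0∞ :=
  ⨅ (f : E → ℝ) (_ : MemLp f 2 μ) (_ : ∫ x, f x ∂μ = 0) (_ : variance f μ = 1),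
    dirichletForm μ κ f

end Performance

/-! ### Acceptance ratios and accept/reject kernels -/

/-- The acceptance ratio `dm₂/dm₁`, for two finite measures: with `ν = m₁ + m₂` and
`η_i = dm_i/dν`, it is `η₂/η₁` where both densities are positive and `0` elsewhere. -/
def accRatio {Z : Type*} [MeasurableSpace Z] (m₁ m₂ : Measure Z) (z : Z) : ℝ≥0∞ :=
  {z | 0 < m₁.rnDeriv (m₁ + m₂) z ∧ 0 < m₂.rnDeriv (m₁ + m₂) z}.indicator
    (fun z => m₂.rnDeriv (m₁ + m₂) z / m₁.rnDeriv (m₁ + m₂) z) z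

lemma measurable_accRatio {Z : Type*} [MeasurableSpace Z] (m₁ m₂ : Measure Z) :
    Measurable (accRatio m₁ m₂) := by
  have h₁ := Measure.measurable_rnDeriv m₁ (m₁ + m₂)
  have h₂ := Measure.measurable_rnDeriv m₂ (m₁ + m₂)
  exact (h₂.div h₁).indicator
    ((measurableSet_lt measurable_const h₁).inter (measurableSet_lt measurable_const h₂))

section AcceptReject

variable {X Z : Type*} [MeasurableSpace X] [MeasurableSpace Z]

/-- The probability of accepting a proposal from `Q x`, when the proposal `z` is accepted with
probability `min 1 (r (x, z))`. -/
def accProb (Q : Kernel X Z) (r : X × Z → ℝ≥0∞) (x : X) : ℝ≥0∞ :=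
  ∫⁻ z, min 1 (r (x, z)) ∂(Q x)

lemma measurable_accProb (Q : Kernel X Z) [IsSFiniteKernel Q] {r : X × Z → ℝ≥0∞}
    (hr : Measurable r) : Measurable (accProb Q r) :=
  Measurable.lintegral_kernel_prod_right' (f := fun p : X × Z => min 1 (r p))
    (measurable_const.min hr)

/-- The accept/reject kernel: from `x`, draw `z` from `Q x`; move to `proj z` with probability
`min 1 (r (x, z))`, otherwise stay at `x`. -/
def acceptReject (Q : Kernel X Z) [IsSFiniteKernel Q] (proj : Z → X) (hproj : Measurable proj)
    (r : X × Z → ℝ≥0∞) (hr : Measurable r) : Kernel X X where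
  toFun x := ((Q x).withDensity (fun z => min 1 (r (x, z)))).map proj
    + (1 - accProb Q r x) • Measure.dirac x
  measurable' := by
    refine Measure.measurable_of_measurable_coe _ fun s hs => ?_
    have h : Measurable (Function.uncurry fun (x : X) (z : Z) => min 1 (r (x, z))) :=
      measurable_const.min hr
    have h₁ := Kernel.measurable_coe ((Q.withDensity fun x z => min 1 (r (x, z))).map proj) hs
    have h₂ : Measurable fun x : X => (1 - accProb Q r x) * Measure.dirac x s :=
      (measurable_const.sub (measurable_accProb Q hr)).mul
        ((Measure.measurable_coe hs).comp Measure.measurable_dirac)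
    convert h₁.add h₂ using 1
    funext x
    simp [Kernel.map_apply _ hproj, Kernel.withDensity_apply _ h]

instance (Q : Kernel X Z) [IsMarkovKernel Q] (proj : Z → X) (hproj : Measurable proj)
    (r : X × Z → ℝ≥0∞) (hr : Measurable r) :
    IsMarkovKernel (acceptReject Q proj hproj r hr) := by
  refine ⟨fun x => ⟨?_⟩⟩
  have hle : accProb Q r x ≤ 1 := by
    calc accProb Q r x ≤ ∫⁻ _, 1 ∂(Q x) := lintegral_mono fun z => min_le_left _ _
      _ = 1 := by simp
  change (((Q x).withDensity (fun z => min 1 (r (x, z)))).map proj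
    + (1 - accProb Q r x) • Measure.dirac x) Set.univ = 1
  rw [Measure.add_apply, Measure.map_apply hproj MeasurableSet.univ, Set.preimage_univ,
    withDensity_apply _ MeasurableSet.univ, Measure.restrict_univ]
  change accProb Q r x + _ = 1
  simp [add_tsub_cancel_of_le hle]

/-- The mixture `½ κ₁ + ½ κ₂`. -/
def halfMix (κ₁ κ₂ : Kernel X X) : Kernel X X where
  toFun x := (2⁻¹ : ℝ≥0∞) • κ₁ x + (2⁻¹ : ℝ≥0∞) • κ₂ x
  measurable' := by
    refine Measure.measurable_of_measurable_coe _ fun s hs => ?_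
    exact ((κ₁.measurable_coe hs).const_mul _).add ((κ₂.measurable_coe hs).const_mul _)

instance (κ₁ κ₂ : Kernel X X) [IsMarkovKernel κ₁] [IsMarkovKernel κ₂] :
    IsMarkovKernel (halfMix κ₁ κ₂) := by
  refine ⟨fun x => ⟨?_⟩⟩
  change ((2⁻¹ : ℝ≥0∞) • κ₁ x + (2⁻¹ : ℝ≥0∞) • κ₂ x) Set.univ = 1
  simp [ENNReal.inv_two_add_inv_two]

end AcceptReject

/-! ### The Metropolis-Hastings kernel -/

section MH

variable {X : Type*} [MeasurableSpace X] (π : Measure X) (q : Kernel X X)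

/-- The Metropolis-Hastings acceptance ratio `r(x, y) = π(dy) q(y, dx) / (π(dx) q(x, dy))`. -/
def mhRatio : X × X → ℝ≥0∞ :=
  accRatio (π ⊗ₘ q) ((π ⊗ₘ q).map Prod.swap)

lemma measurable_mhRatio : Measurable (mhRatio π q) := measurable_accRatio _ _

/-- The Metropolis-Hastings kernel with target `π` and proposal `q`. -/
def mhKernel [IsMarkovKernel q] : Kernel X X :=
  acceptReject q id measurable_id (mhRatio π q) (measurable_mhRatio π q)

instance [IsMarkovKernel q] : IsMarkovKernel (mhKernel π q) := by
  unfold mhKernel; infer_instance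

end MH

/-! ### Finite products of kernels and random choice of an index -/

/-- The kernel `a ↦ ⨂ i, κ i a`. -/
def piKernel {A U ι : Type*} [MeasurableSpace A] [MeasurableSpace U] [Fintype ι]
    (κ : ι → Kernel A U) [∀ i, IsMarkovKernel (κ i)] : Kernel A (ι → U) where
  toFun a := Measure.pi fun i => κ i a
  measurable' := by
    refine Measurable.measure_of_isPiSystem_of_isProbabilityMeasure generateFrom_pi.symm
      isPiSystem_pi ?_
    rintro _ ⟨s, hs, rfl⟩
    simp only [Measure.pi_pi]
    exact Finset.measurable_prod _ fun i _ =>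
      (κ i).measurable_coe (hs i (Set.mem_univ i))

instance {A U ι : Type*} [MeasurableSpace A] [MeasurableSpace U] [Fintype ι]
    (κ : ι → Kernel A U) [∀ i, IsMarkovKernel (κ i)] : IsMarkovKernel (piKernel κ) :=
  ⟨fun a => by change IsProbabilityMeasure (Measure.pi fun i => κ i a); infer_instance⟩

/-- The probability of drawing `k`, given weights `w`: proportional to `w k`. If the sum of the
weights is `0` or `∞`, in which case this makes no sense, `k` is drawn uniformly. -/
def weightProb {N : ℕ} (w : Fin N → ℝ≥0∞) (k : Fin N) : ℝ≥0∞ :=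
  open Classical in
  if ∑ i, w i = 0 ∨ ∑ i, w i = ∞ then (N : ℝ≥0∞)⁻¹ else w k / ∑ i, w i

lemma sum_weightProb {N : ℕ} [NeZero N] (w : Fin N → ℝ≥0∞) : ∑ k, weightProb w k = 1 := by
  unfold weightProb
  split_ifs with h
  · simp [ENNReal.mul_inv_cancel (Nat.cast_ne_zero.2 (NeZero.ne N)) (ENNReal.natCast_ne_top N)]
  · push Not at h
    simp only [div_eq_mul_inv, ← Finset.sum_mul]
    exact ENNReal.mul_inv_cancel h.1 h.2

/-- The kernel that draws the index `k` with probability `weightProb (fun i => w i a) k`. -/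
def indexKernel {A : Type*} [MeasurableSpace A] {N : ℕ} (w : Fin N → A → ℝ≥0∞)
    (hw : ∀ i, Measurable (w i)) : Kernel A (Fin N) where
  toFun a := ∑ k, weightProb (fun i => w i a) k • Measure.dirac k
  measurable' := by
    refine Measure.measurable_of_measurable_coe _ fun s hs => ?_
    have hS : Measurable fun a => ∑ i, w i a := Finset.measurable_sum _ fun i _ => hw i
    simp only [Measure.coe_finsetSum, Finset.sum_apply, Measure.smul_apply, smul_eq_mul]
    refine Finset.measurable_sum _ fun k _ => Measurable.mul_const ?_ _
    unfold weightProb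
    exact Measurable.ite ((hS (measurableSet_singleton 0)).union
      (hS (measurableSet_singleton ∞))) measurable_const ((hw k).div hS)

instance {A : Type*} [MeasurableSpace A] {N : ℕ} [NeZero N] (w : Fin N → A → ℝ≥0∞)
    (hw : ∀ i, Measurable (w i)) : IsMarkovKernel (indexKernel w hw) := by
  refine ⟨fun a => ⟨?_⟩⟩
  change (∑ k, weightProb (fun i => w i a) k • Measure.dirac k : Measure (Fin N)) Set.univ = 1
  simp [sum_weightProb]

/-! ### The MHAAR kernel for averaged acceptance ratios -/

section Averaging

variable {X U : Type*} [MeasurableSpace X] [MeasurableSpace U]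

/-- The kernel `Q̄_{x,y}(A) = Q_{x,y}(φ(A))`, for a measurable involution `φ`: the law of
`φ(u)` for `u ∼ Q_{x,y}`. -/
def barKernel (Q : Kernel (X × X) U) (φ : U → U) (_hφ : Measurable φ) : Kernel (X × X) U :=
  Q.map φ

instance (Q : Kernel (X × X) U) [IsMarkovKernel Q] (φ : U → U) (hφ : Measurable φ) :
    IsMarkovKernel (barKernel Q φ hφ) :=
  Kernel.IsMarkovKernel.map Q hφ

variable (π : Measure X) (q : Kernel X X) (Q : Kernel (X × X) U) (φ : U → U) (hφ : Measurable φ)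

/-- The estimated acceptance ratio
`r̊_u(x, y) = π(dy) q(y, dx) Q̄_{y,x}(du) / (π(dx) q(x, dy) Q_{x,y}(du))`, at `(x, (y, u))`. -/
def ringRatio : X × (X × U) → ℝ≥0∞ :=
  accRatio (π ⊗ₘ (q ⊗ₖ Q))
    ((π ⊗ₘ (q ⊗ₖ barKernel Q φ hφ)).map fun p => (p.2.1, (p.1, p.2.2)))

lemma measurable_ringRatio : Measurable (ringRatio π q Q φ hφ) := measurable_accRatio _ _

/-- The average `r̊_𝔲(x, y) = N⁻¹ ∑ i, r̊_{u i}(x, y)`. -/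
def avgRatio (N : ℕ) (x y : X) (u : Fin N → U) : ℝ≥0∞ :=
  (∑ i, ringRatio π q Q φ hφ (x, (y, u i))) / N

lemma measurable_avgRatio (N : ℕ) : Measurable fun p : X × X × (Fin N → U) =>
    avgRatio π q Q φ hφ N p.1 p.2.1 p.2.2 := by
  refine Measurable.div_const (Finset.measurable_sum _ fun i _ => ?_) _
  refine (measurable_ringRatio π q Q φ hφ).comp ?_
  fun_prop

/-- The first proposal mechanism `Q₁^N`: `y ∼ q(x, ·)`, then `u 1, …, u N` i.i.d. from `Q_{x,y}`,
then `k` with probability proportional to `r̊_{u k}(x, y)`. -/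
def proposal₁ [IsMarkovKernel Q] (N : ℕ) :
    Kernel X (X × ((Fin N → U) × Fin N)) :=
  q ⊗ₖ (piKernel (fun _ : Fin N => Q) ⊗ₖ
    indexKernel (fun i (p : (X × X) × (Fin N → U)) =>
        ringRatio π q Q φ hφ (p.1.1, (p.1.2, p.2 i)))
      (fun i => (measurable_ringRatio π q Q φ hφ).comp (by fun_prop)))

instance [IsMarkovKernel q] [IsMarkovKernel Q] (N : ℕ) [NeZero N] :
    IsMarkovKernel (proposal₁ π q Q φ hφ N) := by
  unfold proposal₁; infer_instance

/-- In the second mechanism, the law of `u i` given `x, y` and `k`: `Q̄_{x,y}` if `i = k`, and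
`Q_{y,x}` otherwise. -/
def aux₂Coord {N : ℕ} (k i : Fin N) : Kernel (X × X) U :=
  if i = k then barKernel Q φ hφ else Q.comap Prod.swap measurable_swap

instance [IsMarkovKernel Q] {N : ℕ} (k i : Fin N) : IsMarkovKernel (aux₂Coord Q φ hφ k i) := by
  unfold aux₂Coord; split_ifs <;> infer_instance

/-- In the second mechanism, the law of `u 1, …, u N` given `x, y` and `k`: independent, with
`u k ∼ Q̄_{x,y}` and `u i ∼ Q_{y,x}` for `i ≠ k`. -/
def aux₂ [IsMarkovKernel Q] (N : ℕ) : Kernel ((X × X) × Fin N) (Fin N → U) where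
  toFun p := piKernel (aux₂Coord Q φ hφ p.2) p.1
  measurable' :=
    measurable_from_prod_countable_left fun k => Kernel.measurable (piKernel (aux₂Coord Q φ hφ k))

instance [IsMarkovKernel Q] (N : ℕ) : IsMarkovKernel (aux₂ Q φ hφ N) :=
  ⟨fun p => inferInstanceAs (IsProbabilityMeasure (piKernel (aux₂Coord Q φ hφ p.2) p.1))⟩

/-- The second proposal mechanism `Q₂^N`: `y ∼ q(x, ·)`, then `k` uniform, then
`u k ∼ Q̄_{x,y}` and `u i ∼ Q_{y,x}` for `i ≠ k`, independently. -/
def proposal₂ [IsMarkovKernel Q] (N : ℕ) :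
    Kernel X (X × (Fin N × (Fin N → U))) :=
  q ⊗ₖ (indexKernel (fun (_ : Fin N) (_ : X × X) => 1) (fun _ => measurable_const) ⊗ₖ
    aux₂ Q φ hφ N)

instance [IsMarkovKernel q] [IsMarkovKernel Q] (N : ℕ) [NeZero N] :
    IsMarkovKernel (proposal₂ q Q φ hφ N) := by
  unfold proposal₂; infer_instance

/-- The acceptance ratio `r̊_𝔲(x, y)` of the first mechanism. -/
def ratio₁ (N : ℕ) (p : X × (X × ((Fin N → U) × Fin N))) : ℝ≥0∞ :=
  avgRatio π q Q φ hφ N p.1 p.2.1 p.2.2.1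

lemma measurable_ratio₁ (N : ℕ) : Measurable (ratio₁ π q Q φ hφ N) :=
  (measurable_avgRatio π q Q φ hφ N).comp
    (g := fun p : X × X × (Fin N → U) => avgRatio π q Q φ hφ N p.1 p.2.1 p.2.2)
    (f := fun p : X × (X × ((Fin N → U) × Fin N)) => (p.1, p.2.1, p.2.2.1)) (by fun_prop)

/-- The acceptance ratio of the second mechanism: the ratio
`π(dy) Q₁^N(y, d(x, 𝔲, k)) / (π(dx) Q₂^N(x, d(y, 𝔲, k)))`. It equals `1 / r̊_𝔲(y, x)` where both
measures have positive density, that is, where `r̊_{u k}(y, x) > 0`, and is `0` elsewhere. -/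
def ratio₂ (N : ℕ) (p : X × (X × (Fin N × (Fin N → U)))) : ℝ≥0∞ :=
  {p : X × (X × (Fin N × (Fin N → U))) |
      0 < ringRatio π q Q φ hφ (p.2.1, (p.1, p.2.2.2 p.2.2.1))}.indicator
    (fun p => (avgRatio π q Q φ hφ N p.2.1 p.1 p.2.2.2)⁻¹) p

lemma measurable_ratio₂ (N : ℕ) : Measurable (ratio₂ π q Q φ hφ N) := by
  refine Measurable.indicator (Measurable.inv ?_) (measurableSet_lt measurable_const ?_)
  · exact (measurable_avgRatio π q Q φ hφ N).comp
      (g := fun p : X × X × (Fin N → U) => avgRatio π q Q φ hφ N p.1 p.2.1 p.2.2)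
      (f := fun p : X × (X × (Fin N × (Fin N → U))) => (p.2.1, p.1, p.2.2.2)) (by fun_prop)
  · refine (measurable_ringRatio π q Q φ hφ).comp ?_
    have h : Measurable fun p : Fin N × (Fin N → U) => p.2 p.1 :=
      measurable_from_prod_countable_right fun k => measurable_pi_apply k
    exact measurable_snd.fst.prodMk (measurable_fst.prodMk (h.comp measurable_snd.snd))

/-- The MHAAR kernel `P̊^N`: with probability `1/2` each, one accept/reject step with the proposal
`Q₁^N` and the ratio `r̊_𝔲(x, y)`, or with the proposal `Q₂^N` and the ratio `1 / r̊_𝔲(y, x)`. -/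
def mhaarKernel [IsMarkovKernel q] [IsMarkovKernel Q] (N : ℕ) [NeZero N] : Kernel X X :=
  halfMix
    (acceptReject (proposal₁ π q Q φ hφ N) Prod.fst measurable_fst
      (ratio₁ π q Q φ hφ N) (measurable_ratio₁ π q Q φ hφ N))
    (acceptReject (proposal₂ q Q φ hφ N) Prod.fst measurable_fst
      (ratio₂ π q Q φ hφ N) (measurable_ratio₂ π q Q φ hφ N))

instance [IsMarkovKernel q] [IsMarkovKernel Q] (N : ℕ) [NeZero N] :
    IsMarkovKernel (mhaarKernel π q Q φ hφ N) := by
  unfold mhaarKernel; infer_instance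

end Averaging

end MHAAR

end

/-!
Both kernels are compared through their Dirichlet forms. Write `ρ_u` for the ratio `r̊_u(x, y)` and
let `a_N(x, y)` be the mean of `min 1 (N⁻¹ ∑ i, ρ_{u i})` for `u i` independent with law `Q_{x,y}`
(`avgAccProb`), so that `π(dx) q(x, dy) a_N(x, y)` is the law of the accepted moves of the first
mechanism. Since `π(dy) q(y, dx) Q̄_{y,x}(du)` has density `ρ_u` with respect to
`π(dx) q(x, dy) Q_{x,y}(du)` on the set where `ρ_u > 0`, and
`(N⁻¹ ∑ k, ρ_{u k}) * min 1 (N⁻¹ ∑ k, ρ_{u k})⁻¹ = min 1 (N⁻¹ ∑ k, ρ_{u k})`, the law of the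
accepted moves of the second mechanism is the image of that measure under the exchange of `x` and
`y` (`lintegral_proposal₂`). Hence off the diagonal the joint law `π ⊗ P̊^N` is the symmetrization
of `a_N (π ⊗ q)` (`lintegral_compProd_mhaarKernel`): the kernel is reversible, and its Dirichlet
form is that of the jump measure `a_N (π ⊗ q)`. The form of the Metropolis-Hastings kernel is
obtained in the same way, with `min 1 r` in place of `a_N`.

An average of `N + 1` ratios is the average of its leave-one-out averages, so concavity of `min 1`
gives `a_N ≤ a_{N+1}` (`avgAccProb_le_succ`). By Jensen and the inequality
`∫ ρ_u Q_{x,y}(du) ≤ r(x, y)`, `a_N ≤ min 1 r` almost everywhere (`avgAccProb_le_mhRatio`). So the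
Dirichlet forms increase with `N` and are bounded by that of `P`; this yields the claims on the
spectral gaps and on the first auto-covariance, which equals `Var f - 𝓔(f)`.

For the asymptotic variances let `T` be the transition operator on `L²(π)`, a self-adjoint
contraction, and `a_k = ⟪f, T^k f⟫` with `f` centred. The scaled variance is
`M⁻¹ ∑ i < M, ∑ j < M, a_{|i - j|}`, a Cesàro mean. No spectral measure is needed: the limit exists
because the numbers `a_{2k} ≥ 0` decrease and `a_{2k} + a_{2k+1} ≥ 0` (`exists_tendsto_toeplitzSum`).
To compare two operators, pass to the Abel means
`∑ k, a_k l ^ k = ⟪f, (1 - l T)⁻¹ f⟫ = sup_h (2 ⟪f, h⟫ - ⟪h, (1 - l T) h⟫)`, which are monotone in `T`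
(`tsum_inner_pow_le`), and return to the Cesàro limits by `le_of_tendsto_toeplitzSum`.
-/

namespace MHAAR

/-! ### Cesàro and Abel means -/

lemma tendsto_of_even_of_odd {α : Type*} {u : ℕ → α} {l : Filter α}
    (he : Tendsto (fun n => u (2 * n)) atTop l)
    (ho : Tendsto (fun n => u (2 * n + 1)) atTop l) : Tendsto u atTop l := by
  intro s hs
  obtain ⟨a, ha⟩ := eventually_atTop.1 (he hs)
  obtain ⟨b, hb⟩ := eventually_atTop.1 (ho hs)
  refine eventually_atTop.2 ⟨2 * (a + b) + 1, fun n hn => ?_⟩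
  obtain ⟨m, rfl | rfl⟩ := Nat.even_or_odd' n
  · exact ha m (by omega)
  · exact hb m (by omega)

lemma tendsto_cesaro_atTop {t : ℕ → ℝ} (ht : Tendsto t atTop atTop) :
    Tendsto (fun n : ℕ => (n : ℝ)⁻¹ * ∑ j ∈ Finset.range n, t j) atTop atTop := by
  refine tendsto_atTop.2 fun K => ?_
  have h1 : Tendsto (fun n => min (t n) (K + 1)) atTop (𝓝 (K + 1)) := by
    refine tendsto_const_nhds.congr' ?_
    filter_upwards [ht.eventually_ge_atTop (K + 1)] with n hn
    rw [min_eq_right hn]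
  filter_upwards [h1.cesaro.eventually_const_lt (by linarith : K < K + 1)] with n hn
  refine hn.le.trans (mul_le_mul_of_nonneg_left ?_ (by positivity))
  exact Finset.sum_le_sum fun j _ => min_le_left _ _

/-- The value of `∑ i < M, ∑ j < M, a |i - j|`, written as a single sum of partial sums of `a`: if
`a` is the auto-covariance sequence of a stationary process, this is the variance of the sum of its
first `M` terms. -/
noncomputable def toeplitzSum (a : ℕ → ℝ) (M : ℕ) : ℝ :=
  ∑ j ∈ Finset.range M, (2 * ∑ k ∈ Finset.range (j + 1), a k - a 0)

/-- Auto-covariance sequences of reversible chains satisfy the hypotheses. The partial sums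
`∑ k < 2 n, a k` increase, so they converge or tend to `∞`; those of odd length may have another
limit (if `-1` is an eigenvalue), but the Cesàro means do not see the oscillation. -/
lemma exists_tendsto_toeplitzSum {a : ℕ → ℝ} (hanti : Antitone fun n => a (2 * n))
    (hnn : ∀ n, 0 ≤ a (2 * n)) (hpair : ∀ n, 0 ≤ a (2 * n) + a (2 * n + 1)) :
    ∃ L : ℝ≥0∞, Tendsto (fun M : ℕ => ENNReal.ofReal ((M : ℝ)⁻¹ * toeplitzSum a M)) atTop (𝓝 L) := by
  set S : ℕ → ℝ := fun n => ∑ k ∈ Finset.range n, a k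
  have hSs : ∀ n, S (n + 1) = S n + a n := fun n => Finset.sum_range_succ _ _
  have hV : ∀ M, toeplitzSum a M = ∑ j ∈ Finset.range M, (2 * S (j + 1) - a 0) := fun M => rfl
  clear_value S
  have hmono : Monotone fun n => S (2 * n) := by
    refine monotone_nat_of_le_succ fun n => ?_
    have : S (2 * (n + 1)) = S (2 * n) + a (2 * n) + a (2 * n + 1) := by
      rw [show 2 * (n + 1) = 2 * n + 1 + 1 by ring, hSs, hSs]
    simp only [this]
    linarith [hpair n]
  set t : ℕ → ℝ := fun j => 2 * S (j + 1) - a 0 with ht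
  replace hV : ∀ M, toeplitzSum a M = ∑ j ∈ Finset.range M, t j := hV
  rcases tendsto_atTop_of_monotone hmono with h | ⟨B, hB⟩
  · refine ⟨∞, ?_⟩
    simp only [hV]
    refine ENNReal.tendsto_ofReal_atTop.comp (tendsto_cesaro_atTop ?_)
    have h' : Tendsto (fun n => 2 * S (2 * n) + -a 0) atTop atTop :=
      tendsto_atTop_add_const_right _ _ (h.const_mul_atTop two_pos)
    refine tendsto_of_even_of_odd (tendsto_atTop_mono (fun n => ?_) h') ?_
    · simp only [ht, hSs]; linarith [hnn n]
    · refine tendsto_atTop_mono (fun n => ?_) (h'.comp (tendsto_add_atTop_nat 1))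
      simp only [ht, Function.comp, sub_eq_add_neg]
      rw [show 2 * (n + 1) = 2 * n + 1 + 1 by ring]
  · obtain ⟨α, hα⟩ : ∃ α, Tendsto (fun n => a (2 * n)) atTop (𝓝 α) := by
      rcases tendsto_atTop_of_antitone hanti with h | h
      · obtain ⟨n, hn⟩ := (h.eventually_lt_atBot 0).exists
        exact absurd hn (not_lt.2 (hnn n))
      · exact h
    have hB' : Tendsto (fun n => S (2 * n + 2)) atTop (𝓝 B) := hB.comp (tendsto_add_atTop_nat 1)
    have hα' : Tendsto (fun n => a (2 * n + 2)) atTop (𝓝 α) := hα.comp (tendsto_add_atTop_nat 1)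
    have ho : Tendsto (fun n => S (2 * n + 1)) atTop (𝓝 (B + α)) := by
      simpa only [hSs] using hB.add hα
    have ho' : Tendsto (fun n => S (2 * n + 3)) atTop (𝓝 (B + α)) :=
      ho.comp (tendsto_add_atTop_nat 1)
    -- Consecutive partial sums have a convergent average.
    set e : ℕ → ℝ := fun j => S (j + 1) + S (j + 2) - a 0 with he
    have hlim : Tendsto e atTop (𝓝 (2 * B + α - a 0)) := by
      refine tendsto_of_even_of_odd ?_ ?_
      · convert! (ho.add hB').sub_const (a 0) using 2; ring
      · convert! (hB'.add ho').sub_const (a 0) using 2; ring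
    have hsum : ∀ M, toeplitzSum a M = ∑ j ∈ Finset.range M, e j - (S (M + 1) - S 1) := by
      intro M
      induction M with
      | zero => simp [toeplitzSum]
      | succ M ih =>
        rw [Finset.sum_range_succ, hV, Finset.sum_range_succ, ← hV, ih]
        simp only [ht, he]
        ring
    have hbdd : Tendsto (fun M : ℕ => (M : ℝ)⁻¹ * (S (M + 1) - S 1)) atTop (𝓝 0) := by
      have h0 : Tendsto (fun M : ℕ => (M : ℝ)⁻¹) atTop (𝓝 0) := tendsto_inv_atTop_nhds_zero_nat
      have h2 : Tendsto (fun n : ℕ => 2 * n) atTop atTop :=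
        tendsto_atTop_mono (fun n => by change n ≤ _; omega) tendsto_id
      have h3 : Tendsto (fun n : ℕ => 2 * n + 1) atTop atTop :=
        tendsto_atTop_mono (fun n => by change n ≤ _; omega) tendsto_id
      refine tendsto_of_even_of_odd ?_ ?_
      · rw [← zero_mul (B + α - S 1)]
        exact (h0.comp h2).mul (ho.sub_const (S 1))
      · rw [← zero_mul (B - S 1)]
        exact (h0.comp h3).mul (hB'.sub_const (S 1))
    refine ⟨ENNReal.ofReal (2 * B + α - a 0), ENNReal.tendsto_ofReal ?_⟩
    have := hlim.cesaro.sub hbdd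
    rw [sub_zero] at this
    refine this.congr fun M => ?_
    rw [hsum]; ring

/-- Abel summation: the generating function of the partial sums. -/
lemma tsum_partialSum_mul_pow {u : ℕ → ℝ} {l : ℝ} (hl0 : 0 ≤ l) (hl1 : l < 1)
    (hu : Summable fun k => ‖u k * l ^ k‖) :
    (Summable fun n => ‖(∑ k ∈ Finset.range (n + 1), u k) * l ^ n‖) ∧
      ∑' n, (∑ k ∈ Finset.range (n + 1), u k) * l ^ n = (∑' k, u k * l ^ k) * (1 - l)⁻¹ := by
  have hg : Summable fun k => ‖l ^ k‖ := by
    simpa [abs_of_nonneg hl0] using summable_geometric_of_lt_one hl0 hl1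
  have key : ∀ n, (∑ k ∈ Finset.range (n + 1), u k) * l ^ n
      = ∑ k ∈ Finset.range (n + 1), u k * l ^ k * l ^ (n - k) := by
    intro n
    rw [Finset.sum_mul]
    refine Finset.sum_congr rfl fun k hk => ?_
    rw [mul_assoc, ← pow_add, Nat.add_sub_cancel' (Nat.lt_succ_iff.1 (Finset.mem_range.1 hk))]
  simp only [key]
  refine ⟨summable_norm_sum_mul_range_of_summable_norm hu hg, ?_⟩
  rw [← tsum_mul_tsum_eq_tsum_sum_range_of_summable_norm hu hg, tsum_geometric_of_lt_one hl0 hl1]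

/-- A Tauberian-type comparison: an inequality between the Abel sums of two sequences is inherited by
the limits of their (twice summed) Cesàro means. -/
lemma le_of_tendsto_toeplitzSum {a b : ℕ → ℝ} {La Lb : ℝ≥0∞} (h0 : a 0 = b 0)
    (ha : ∀ l : ℝ, 0 ≤ l → l < 1 → Summable fun k => ‖a k * l ^ k‖)
    (hb : ∀ l : ℝ, 0 ≤ l → l < 1 → Summable fun k => ‖b k * l ^ k‖)
    (hab : ∀ l : ℝ, 0 ≤ l → l < 1 → ∑' k, a k * l ^ k ≤ ∑' k, b k * l ^ k)
    (hLa : Tendsto (fun M : ℕ => ENNReal.ofReal ((M : ℝ)⁻¹ * toeplitzSum a M)) atTop (𝓝 La))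
    (hLb : Tendsto (fun M : ℕ => ENNReal.ofReal ((M : ℝ)⁻¹ * toeplitzSum b M)) atTop (𝓝 Lb)) :
    La ≤ Lb := by
  by_contra! hlt
  obtain ⟨c, hbc, hca⟩ := exists_between hlt
  obtain ⟨c', hcc', hc'a⟩ := exists_between hca
  have hc'top : c' ≠ ∞ := hc'a.ne_top
  set d : ℕ → ℝ := fun k => a k - b k with hd
  set D : ℕ → ℝ := fun n => ∑ j ∈ Finset.range (n + 1), ∑ k ∈ Finset.range (j + 1), d k with hD
  -- If `Lb < La`, the twice summed differences `D` are eventually bounded below by some `ε > 0`.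
  obtain ⟨ε, hε, n₀, hn₀⟩ : ∃ ε > 0, ∃ n₀, ∀ n ≥ n₀, ε ≤ D n := by
    have hpos : 0 < c'.toReal - c.toReal := by
      rw [sub_pos]; exact ENNReal.toReal_strict_mono hc'top hcc'
    refine ⟨(c'.toReal - c.toReal) / 2, half_pos hpos, ?_⟩
    have hev := (hLa.eventually_const_lt hc'a).and (hLb.eventually_lt_const hbc)
    have hev' := (tendsto_add_atTop_nat 1).eventually hev
    obtain ⟨n₀, hn₀⟩ := eventually_atTop.1 hev'
    refine ⟨n₀, fun n hn => ?_⟩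
    obtain ⟨h1, h2⟩ := hn₀ n hn
    have hM : (0 : ℝ) < ((n + 1 : ℕ) : ℝ) := by positivity
    have h1' : c'.toReal < ((n + 1 : ℕ) : ℝ)⁻¹ * toeplitzSum a (n + 1) := by
      rw [← ENNReal.ofReal_toReal hc'top] at h1
      exact (ENNReal.ofReal_lt_ofReal_iff_of_nonneg ENNReal.toReal_nonneg).1 h1
    have h2' : ((n + 1 : ℕ) : ℝ)⁻¹ * toeplitzSum b (n + 1) < c.toReal := by
      rw [← ENNReal.ofReal_toReal (hcc'.trans_le le_top).ne] at h2
      exact ENNReal.ofReal_lt_ofReal_iff'.1 h2 |>.1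
    have hdiff : toeplitzSum a (n + 1) - toeplitzSum b (n + 1) = 2 * D n := by
      simp only [toeplitzSum, hD, hd]
      rw [← Finset.sum_sub_distrib, Finset.mul_sum]
      refine Finset.sum_congr rfl fun j _ => ?_
      rw [Finset.sum_sub_distrib, h0]
      ring
    have h3 : c'.toReal - c.toReal < ((n + 1 : ℕ) : ℝ)⁻¹ * (2 * D n) := by
      rw [← hdiff, mul_sub]; linarith
    rw [inv_mul_eq_div, lt_div_iff₀ hM] at h3
    have : (1 : ℝ) ≤ ((n + 1 : ℕ) : ℝ) := by exact_mod_cast Nat.le_add_left 1 n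
    nlinarith
  have hpart : ∀ m ≥ n₀, ∀ l : ℝ, 0 ≤ l → l < 1 → ∑ n ∈ Finset.range m, D n * l ^ n ≤ 0 := by
    intro m hm l hl0 hl1
    have hsd : Summable fun k => ‖d k * l ^ k‖ := by
      refine ((ha l hl0 hl1).add (hb l hl0 hl1)).of_nonneg_of_le (fun _ => norm_nonneg _)
        fun k => ?_
      simp only [hd, sub_mul]
      exact norm_sub_le _ _
    obtain ⟨h1, h1'⟩ := tsum_partialSum_mul_pow hl0 hl1 hsd
    obtain ⟨h2, h2'⟩ := tsum_partialSum_mul_pow hl0 hl1 h1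
    have hle : ∑' k, d k * l ^ k ≤ 0 := by
      simp only [hd, sub_mul]
      rw [((ha l hl0 hl1).of_norm).tsum_sub ((hb l hl0 hl1).of_norm)]
      linarith [hab l hl0 hl1]
    have hinv : 0 ≤ (1 - l)⁻¹ := inv_nonneg.2 (by linarith)
    have htot : ∑' n, D n * l ^ n ≤ 0 := by
      rw [h2', h1']
      exact mul_nonpos_of_nonpos_of_nonneg (mul_nonpos_of_nonpos_of_nonneg hle hinv) hinv
    refine le_trans ?_ htot
    refine h2.of_norm.sum_le_tsum (Finset.range m) fun n hn => ?_
    exact mul_nonneg (hε.le.trans (hn₀ n (hm.trans (not_lt.1 (mt Finset.mem_range.2 hn)))))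
      (pow_nonneg hl0 n)
  have hpart1 : ∀ m ≥ n₀, ∑ n ∈ Finset.range m, D n ≤ 0 := by
    intro m hm
    have hcont : Tendsto (fun l : ℝ => ∑ n ∈ Finset.range m, D n * l ^ n) (𝓝[<] 1)
        (𝓝 (∑ n ∈ Finset.range m, D n * 1 ^ n)) :=
      ((by fun_prop : Continuous fun l : ℝ => ∑ n ∈ Finset.range m, D n * l ^ n).tendsto
        1).mono_left nhdsWithin_le_nhds
    simp only [one_pow, mul_one] at hcont
    refine le_of_tendsto hcont ?_
    filter_upwards [Ioo_mem_nhdsLT (zero_lt_one' ℝ)] with l hl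
    exact hpart m hm l hl.1.le hl.2
  have hgrow : ∀ j : ℕ, ∑ n ∈ Finset.range n₀, D n + j * ε ≤ ∑ n ∈ Finset.range (n₀ + j), D n := by
    intro j
    induction j with
    | zero => simp
    | succ j ih =>
      rw [← add_assoc, Finset.sum_range_succ]
      push_cast
      linarith [hn₀ (n₀ + j) (Nat.le_add_right _ _)]
  obtain ⟨j, hj⟩ := exists_nat_gt (-(∑ n ∈ Finset.range n₀, D n) / ε)
  rw [div_lt_iff₀ hε] at hj
  linarith [hgrow j, hpart1 (n₀ + j) (Nat.le_add_right _ _)]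

/-! ### Self-adjoint contractions of a Hilbert space -/

section Hilbert

variable {H : Type*} [NormedAddCommGroup H] [InnerProductSpace ℝ H]

open scoped InnerProductSpace

lemma inner_pow_add {T : H →L[ℝ] H} (hT : (T : H →ₗ[ℝ] H).IsSymmetric) (f : H) (j k : ℕ) :
    ⟪f, (T ^ (j + k)) f⟫_ℝ = ⟪(T ^ j) f, (T ^ k) f⟫_ℝ := by
  induction j generalizing k with
  | zero => simp
  | succ j ih =>
    rw [show j + 1 + k = j + (k + 1) by ring, ih, pow_succ', pow_succ']
    exact (hT _ _).symm

lemma norm_pow_apply_le {T : H →L[ℝ] H} (hn : ‖T‖ ≤ 1) (f : H) (k : ℕ) : ‖(T ^ k) f‖ ≤ ‖f‖ := by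
  induction k with
  | zero => simp
  | succ k ih =>
    rw [pow_succ']
    exact ((T.le_opNorm _).trans (mul_le_of_le_one_left (norm_nonneg _) hn)).trans ih

lemma exists_tendsto_toeplitzSum_inner_pow {T : H →L[ℝ] H}
    (hT : (T : H →ₗ[ℝ] H).IsSymmetric) (hn : ‖T‖ ≤ 1) (f : H) :
    ∃ L : ℝ≥0∞, Tendsto (fun M : ℕ => ENNReal.ofReal
      ((M : ℝ)⁻¹ * toeplitzSum (fun k => ⟪f, (T ^ k) f⟫_ℝ) M)) atTop (𝓝 L) := by
  have heven : ∀ n, ⟪f, (T ^ (2 * n)) f⟫_ℝ = ‖(T ^ n) f‖ ^ 2 := fun n => by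
    rw [two_mul, inner_pow_add hT, real_inner_self_eq_norm_sq]
  have hTle : ∀ g, ‖T g‖ ≤ ‖g‖ := fun g =>
    (T.le_opNorm _).trans (mul_le_of_le_one_left (norm_nonneg _) hn)
  refine exists_tendsto_toeplitzSum ?_ ?_ ?_
  · refine antitone_nat_of_succ_le fun n => ?_
    simp only [heven, pow_succ' T]
    exact pow_le_pow_left₀ (norm_nonneg _) (hTle _) 2
  · intro n; rw [heven]; positivity
  · intro n
    rw [heven, two_mul, add_assoc, inner_pow_add hT, pow_succ' T]
    have h1 := abs_real_inner_le_norm ((T ^ n) f) (T ((T ^ n) f))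
    have h2 := hTle ((T ^ n) f)
    have h3 := neg_abs_le ⟪(T ^ n) f, T ((T ^ n) f)⟫_ℝ
    change 0 ≤ _ + ⟪(T ^ n) f, T ((T ^ n) f)⟫_ℝ
    nlinarith [norm_nonneg ((T ^ n) f)]

lemma summable_norm_inner_pow_mul_pow {T : H →L[ℝ] H} (hn : ‖T‖ ≤ 1) (f : H) {l : ℝ}
    (hl0 : 0 ≤ l) (hl1 : l < 1) : Summable fun k => ‖⟪f, (T ^ k) f⟫_ℝ * l ^ k‖ := by
  refine ((summable_geometric_of_lt_one hl0 hl1).mul_left (‖f‖ * ‖f‖)).of_nonneg_of_le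
    (fun _ => norm_nonneg _) fun k => ?_
  rw [norm_mul, norm_pow, Real.norm_of_nonneg hl0]
  refine mul_le_mul_of_nonneg_right ?_ (by positivity)
  exact (norm_inner_le_norm _ _).trans
    (mul_le_mul_of_nonneg_left (norm_pow_apply_le hn f k) (norm_nonneg _))

variable [CompleteSpace H]

/-- The resolvent vector `g = (1 - l T)⁻¹ f`. -/
lemma exists_resolvent {T : H →L[ℝ] H} (hn : ‖T‖ ≤ 1) (f : H) {l : ℝ} (hl0 : 0 ≤ l)
    (hl1 : l < 1) : ∃ g : H, g - l • T g = f ∧ ∑' k, ⟪f, (T ^ k) f⟫_ℝ * l ^ k = ⟪f, g⟫_ℝ := by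
  have hlt : ‖l • T‖ < 1 := by
    rw [norm_smul, Real.norm_of_nonneg hl0]
    nlinarith [norm_nonneg T]
  have hs := summable_geometric_of_norm_lt_one hlt
  have hg : HasSum (fun k => ((l • T) ^ k) f) ((∑' k, (l • T) ^ k) f) :=
    hs.hasSum.mapL (ContinuousLinearMap.apply ℝ H f)
  refine ⟨(∑' k, (l • T) ^ k) f, ?_, ?_⟩
  · have := DFunLike.congr_fun (mul_neg_geom_series (l • T) hlt) f
    simpa using this
  · refine Eq.trans ?_ (hg.mapL (innerSL ℝ f)).tsum_eq
    refine tsum_congr fun k => ?_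
    simp [smul_pow, mul_comm]

/-- The Abel sums increase with the operator, since `⟪f, (1 - l T)⁻¹ f⟫` is the maximum over `h` of
`2 ⟪f, h⟫ - ⟪h, (1 - l T) h⟫`. -/
lemma tsum_inner_pow_le {S T : H →L[ℝ] H} (hT : (T : H →ₗ[ℝ] H).IsSymmetric)
    (hSn : ‖S‖ ≤ 1) (hTn : ‖T‖ ≤ 1) (hST : ∀ h, ⟪h, S h⟫_ℝ ≤ ⟪h, T h⟫_ℝ) (f : H) {l : ℝ}
    (hl0 : 0 ≤ l) (hl1 : l < 1) :
    ∑' k, ⟪f, (S ^ k) f⟫_ℝ * l ^ k ≤ ∑' k, ⟪f, (T ^ k) f⟫_ℝ * l ^ k := by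
  obtain ⟨g, hg, hg'⟩ := exists_resolvent hSn f hl0 hl1
  obtain ⟨h, hh, hh'⟩ := exists_resolvent hTn f hl0 hl1
  rw [hg', hh']
  -- Expand `0 ≤ ⟪h - g, (1 - l T) (h - g)⟫`.
  have hpos : 0 ≤ ⟪h - g, (h - g) - l • T (h - g)⟫_ℝ := by
    rw [inner_sub_right, inner_smul_right, real_inner_self_eq_norm_sq]
    have h1 := real_inner_le_norm (h - g) (T (h - g))
    have h2 : ‖T (h - g)‖ ≤ ‖h - g‖ :=
      (T.le_opNorm _).trans (mul_le_of_le_one_left (norm_nonneg _) hTn)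
    have h3 : ⟪h - g, T (h - g)⟫_ℝ ≤ ‖h - g‖ ^ 2 := by nlinarith [norm_nonneg (h - g)]
    nlinarith [sq_nonneg ‖h - g‖]
  have e1 : (h - g) - l • T (h - g) = f - (g - l • T g) := by
    rw [← hh, map_sub, smul_sub]; abel
  have e2 : ⟪h, g - l • T g⟫_ℝ = ⟪f, g⟫_ℝ := by
    rw [← hh, inner_sub_right, inner_sub_left, inner_smul_left, inner_smul_right]
    have : ⟪h, T g⟫_ℝ = ⟪T h, g⟫_ℝ := (hT h g).symm
    simp [this]
  have e3 : ⟪g, g - l • T g⟫_ℝ ≤ ⟪g, f⟫_ℝ := by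
    conv_rhs => rw [← hg]
    rw [inner_sub_right, inner_sub_right, inner_smul_right, inner_smul_right]
    linarith [mul_le_mul_of_nonneg_left (hST g) hl0]
  rw [e1, inner_sub_left, inner_sub_right h, inner_sub_right g f, e2] at hpos
  have e4 := real_inner_comm h f
  have e5 := real_inner_comm g f
  linarith

/-- If `S ≤ T` as quadratic forms, then the limiting Cesàro variance for `S` is at most that
for `T`. -/
lemma le_of_tendsto_toeplitzSum_inner_pow {S T : H →L[ℝ] H} (hT : (T : H →ₗ[ℝ] H).IsSymmetric)
    (hSn : ‖S‖ ≤ 1) (hTn : ‖T‖ ≤ 1) (hST : ∀ h, ⟪h, S h⟫_ℝ ≤ ⟪h, T h⟫_ℝ) (f : H) {LS LT : ℝ≥0∞}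
    (hLS : Tendsto (fun M : ℕ => ENNReal.ofReal
      ((M : ℝ)⁻¹ * toeplitzSum (fun k => ⟪f, (S ^ k) f⟫_ℝ) M)) atTop (𝓝 LS))
    (hLT : Tendsto (fun M : ℕ => ENNReal.ofReal
      ((M : ℝ)⁻¹ * toeplitzSum (fun k => ⟪f, (T ^ k) f⟫_ℝ) M)) atTop (𝓝 LT)) : LS ≤ LT :=
  le_of_tendsto_toeplitzSum (by simp) (fun _ h0 h1 => summable_norm_inner_pow_mul_pow hSn f h0 h1)
    (fun _ h0 h1 => summable_norm_inner_pow_mul_pow hTn f h0 h1)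
    (fun _ h0 h1 => tsum_inner_pow_le hT hSn hTn hST f h0 h1) hLS hLT

end Hilbert

/-! ### The transition operator of a reversible kernel -/

section Operator

open scoped InnerProductSpace

variable {E : Type*} [MeasurableSpace E] {μ : Measure E} [IsProbabilityMeasure μ]
  {κ : Kernel E E} [IsMarkovKernel κ]

lemma integral_comp_of_measurePreserving {Ω : Type*} [MeasurableSpace Ω] {ρ : Measure Ω}
    {ν : Measure E} {T : Ω → E} (hT : MeasurePreserving T ρ ν) {g : E → ℝ}
    (hg : AEStronglyMeasurable g ν) : ∫ ω, g (T ω) ∂ρ = ∫ x, g x ∂ν := by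
  rw [← hT.map_eq] at hg ⊢
  exact (integral_map hT.measurable.aemeasurable hg).symm

lemma integrable_integral_of_compProd {A B : Type*} [MeasurableSpace A] [MeasurableSpace B]
    {ν : Measure A} [SFinite ν] {η : Kernel A B} [IsSFiniteKernel η] {f : A × B → ℝ}
    (hf : Integrable f (ν ⊗ₘ η)) : Integrable (fun x => ∫ y, f (x, y) ∂(η x)) ν :=
  Integrable.integral_compProd (κ := Kernel.const Unit ν) (η := Kernel.prodMkLeft Unit η)
    (a := ()) hf

lemma isReversible_of_map_swap_compProd (h : (μ ⊗ₘ κ).map Prod.swap = μ ⊗ₘ κ) :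
    κ.IsReversible μ := by
  intro A B hA hB
  rw [← Measure.compProd_apply_prod hA hB, ← h, Measure.map_apply measurable_swap (hA.prod hB),
    Set.preimage_swap_prod, Measure.compProd_apply_prod hB hA]

lemma map_swap_compProd (h : κ.IsReversible μ) : (μ ⊗ₘ κ).map Prod.swap = μ ⊗ₘ κ := by
  have := Measure.isFiniteMeasure_map (μ ⊗ₘ κ) Prod.swap
  refine Measure.ext_prod fun hA hB => ?_
  rw [Measure.map_apply measurable_swap (hA.prod hB), Set.preimage_swap_prod,
    Measure.compProd_apply_prod hB hA, Measure.compProd_apply_prod hA hB, h hB hA]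

lemma measurePreserving_fst_compProd : MeasurePreserving Prod.fst (μ ⊗ₘ κ) μ :=
  ⟨measurable_fst, Measure.fst_compProd μ κ⟩

lemma measurePreserving_swap_compProd (h : κ.IsReversible μ) :
    MeasurePreserving Prod.swap (μ ⊗ₘ κ) (μ ⊗ₘ κ) :=
  ⟨measurable_swap, map_swap_compProd h⟩

lemma measurePreserving_snd_compProd (h : κ.IsReversible μ) :
    MeasurePreserving Prod.snd (μ ⊗ₘ κ) μ :=
  measurePreserving_fst_compProd.comp (measurePreserving_swap_compProd h)

/-- The transition operator `f ↦ ∫ f(y) κ(·, dy)` on `L²(μ)`. It is defined by duality, as the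
operator representing the form `(f, g) ↦ ∫ f(x) g(y) μ(dx) κ(x, dy)`, so that it does not depend on
the choice of representatives; see `coeFn_transOp` for the pointwise formula. -/
noncomputable def transOp (h : κ.IsReversible μ) : Lp ℝ 2 μ →L[ℝ] Lp ℝ 2 μ :=
  (ContinuousLinearMap.adjoint (Lp.compMeasurePreservingₗᵢ ℝ Prod.fst
    (measurePreserving_fst_compProd (μ := μ) (κ := κ))).toContinuousLinearMap).comp
    (Lp.compMeasurePreservingₗᵢ ℝ Prod.snd (measurePreserving_snd_compProd h)).toContinuousLinearMap

omit [IsProbabilityMeasure μ] in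
lemma inner_eq_integral (f g : Lp ℝ 2 μ) : ⟪f, g⟫_ℝ = ∫ x, f x * g x ∂μ := by
  rw [L2.inner_def]
  exact integral_congr_ae (Eventually.of_forall fun x => by simp [mul_comm])

lemma inner_transOp (h : κ.IsReversible μ) (f g : Lp ℝ 2 μ) :
    ⟪f, transOp h g⟫_ℝ = ∫ z, f z.1 * g z.2 ∂(μ ⊗ₘ κ) := by
  rw [transOp, ContinuousLinearMap.comp_apply, ContinuousLinearMap.adjoint_inner_right,
    inner_eq_integral]
  refine integral_congr_ae ?_
  filter_upwards [Lp.coeFn_compMeasurePreserving f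
    (measurePreserving_fst_compProd (μ := μ) (κ := κ)),
    Lp.coeFn_compMeasurePreserving g (measurePreserving_snd_compProd h)] with z h1 h2
  exact congr_arg₂ (· * ·) h1 h2

lemma transOp_isSymmetric (h : κ.IsReversible μ) :
    (transOp h : Lp ℝ 2 μ →ₗ[ℝ] Lp ℝ 2 μ).IsSymmetric := by
  intro f g
  rw [real_inner_comm]
  change ⟪g, transOp h f⟫_ℝ = ⟪f, transOp h g⟫_ℝ
  rw [inner_transOp, inner_transOp,
    ← (measurePreserving_swap_compProd h).integral_comp MeasurableEquiv.prodComm.measurableEmbedding]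
  simp [mul_comm]

lemma norm_transOp_le (h : κ.IsReversible μ) : ‖transOp h‖ ≤ 1 := by
  refine (ContinuousLinearMap.opNorm_comp_le _ _).trans ?_
  rw [LinearIsometryEquiv.norm_map]
  exact mul_le_one₀ (LinearIsometry.norm_toContinuousLinearMap_le _) (norm_nonneg _)
    (LinearIsometry.norm_toContinuousLinearMap_le _)

lemma coeFn_transOp (h : κ.IsReversible μ) (g : Lp ℝ 2 μ) :
    transOp h g =ᵐ[μ] fun x => ∫ y, g y ∂(κ x) := by
  have hg : Integrable (fun z : E × E => g z.2) (μ ⊗ₘ κ) :=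
    ((Lp.memLp g).comp_measurePreserving (measurePreserving_snd_compProd h)).integrable
      one_le_two
  refine Integrable.ae_eq_of_forall_setIntegral_eq _ _ ((Lp.memLp _).integrable one_le_two)
    (integrable_integral_of_compProd hg) fun s hs _ => ?_
  · have h1 : ⟪indicatorConstLp 2 hs (measure_ne_top μ s) (1 : ℝ), transOp h g⟫_ℝ
        = ∫ x in s, transOp h g x ∂μ := by
      rw [L2.inner_indicatorConstLp_one]
    rw [← h1, inner_transOp]
    have h2 : ∫ z, indicatorConstLp 2 hs (measure_ne_top μ s) (1 : ℝ) z.1 * g z.2 ∂(μ ⊗ₘ κ)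
        = ∫ z in s ×ˢ Set.univ, g z.2 ∂(μ ⊗ₘ κ) := by
      rw [← integral_indicator (hs.prod MeasurableSet.univ)]
      refine integral_congr_ae ?_
      filter_upwards [(measurePreserving_fst_compProd (μ := μ) (κ := κ)).quasiMeasurePreserving.ae
        (indicatorConstLp_coeFn (p := 2) (hs := hs) (hμs := measure_ne_top μ s)
          (c := (1 : ℝ)))] with z hz
      rw [hz]
      by_cases hzs : z.1 ∈ s <;> simp [hzs]
    rw [h2, Measure.setIntegral_compProd hs MeasurableSet.univ hg.integrableOn]
    simp

lemma dirichletForm_eq_ofReal (h : κ.IsReversible μ) {f : E → ℝ} (hf : MemLp f 2 μ) :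
    dirichletForm μ κ f
      = ENNReal.ofReal (⟪hf.toLp f, hf.toLp f⟫_ℝ - ⟪hf.toLp f, transOp h (hf.toLp f)⟫_ℝ) := by
  have h1 : MemLp (fun z : E × E => f z.1) 2 (μ ⊗ₘ κ) :=
    hf.comp_measurePreserving measurePreserving_fst_compProd
  have h2 : MemLp (fun z : E × E => f z.2) 2 (μ ⊗ₘ κ) :=
    hf.comp_measurePreserving (measurePreserving_snd_compProd h)
  have hff : ⟪hf.toLp f, hf.toLp f⟫_ℝ = ∫ x, f x ^ 2 ∂μ := by
    rw [inner_eq_integral]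
    refine integral_congr_ae ?_
    filter_upwards [hf.coeFn_toLp] with x hx
    rw [hx, sq]
  have hfT : ⟪hf.toLp f, transOp h (hf.toLp f)⟫_ℝ = ∫ z, f z.1 * f z.2 ∂(μ ⊗ₘ κ) := by
    rw [inner_transOp]
    refine integral_congr_ae ?_
    filter_upwards [(measurePreserving_fst_compProd (μ := μ)
      (κ := κ)).quasiMeasurePreserving.ae hf.coeFn_toLp,
      (measurePreserving_snd_compProd h).quasiMeasurePreserving.ae hf.coeFn_toLp] with z hz hz'
    rw [hz, hz']
  have e1 : ∫ z, f z.1 ^ 2 ∂(μ ⊗ₘ κ) = ∫ x, f x ^ 2 ∂μ :=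
    integral_comp_of_measurePreserving measurePreserving_fst_compProd (hf.1.pow 2)
  have e2 : ∫ z, f z.2 ^ 2 ∂(μ ⊗ₘ κ) = ∫ x, f x ^ 2 ∂μ :=
    integral_comp_of_measurePreserving (measurePreserving_snd_compProd h) (hf.1.pow 2)
  have hsq : Integrable (fun z : E × E => (f z.1 - f z.2) ^ 2) (μ ⊗ₘ κ) := (h1.sub h2).integrable_sq
  have key : ∫ z, (f z.1 - f z.2) ^ 2 ∂(μ ⊗ₘ κ)
      = 2 * (∫ x, f x ^ 2 ∂μ - ∫ z, f z.1 * f z.2 ∂(μ ⊗ₘ κ)) := by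
    have : ∀ z : E × E, (f z.1 - f z.2) ^ 2 = f z.1 ^ 2 + f z.2 ^ 2 - 2 * (f z.1 * f z.2) :=
      fun z => by ring
    have hI : Integrable (fun z : E × E => f z.1 * f z.2) (μ ⊗ₘ κ) := h1.integrable_mul h2
    have hI' : Integrable (fun z : E × E => f z.1 ^ 2 + f z.2 ^ 2) (μ ⊗ₘ κ) :=
      h1.integrable_sq.add h2.integrable_sq
    simp only [this]
    rw [integral_sub hI' (hI.const_mul 2), integral_add h1.integrable_sq h2.integrable_sq, integral_const_mul, e1, e2]
    ring
  rw [dirichletForm, ← ofReal_integral_eq_lintegral_ofReal hsq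
    (Eventually.of_forall fun z => sq_nonneg _), key, hff, hfT,
    ENNReal.ofReal_mul zero_le_two, ← mul_assoc]
  simp [ENNReal.inv_mul_cancel]

lemma inner_transOp_le_inner_self (h : κ.IsReversible μ) (f : Lp ℝ 2 μ) :
    ⟪f, transOp h f⟫_ℝ ≤ ⟪f, f⟫_ℝ := by
  rw [real_inner_self_eq_norm_sq, sq]
  exact (real_inner_le_norm _ _).trans (mul_le_mul_of_nonneg_left
    (((transOp h).le_opNorm f).trans (mul_le_of_le_one_left (norm_nonneg _) (norm_transOp_le h)))
    (norm_nonneg _))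

/-- An ordering of Dirichlet forms reverses the ordering of transition operators. -/
lemma inner_transOp_le_of_dirichletForm_le {κ' : Kernel E E} [IsMarkovKernel κ']
    (h : κ.IsReversible μ) (h' : κ'.IsReversible μ)
    (hle : ∀ f : E → ℝ, MemLp f 2 μ → dirichletForm μ κ f ≤ dirichletForm μ κ' f)
    (f : Lp ℝ 2 μ) : ⟪f, transOp h' f⟫_ℝ ≤ ⟪f, transOp h f⟫_ℝ := by
  have := hle f (Lp.memLp f)
  rw [dirichletForm_eq_ofReal h (Lp.memLp f), dirichletForm_eq_ofReal h' (Lp.memLp f),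
    Lp.toLp_coeFn, ENNReal.ofReal_le_ofReal_iff (sub_nonneg.2 (inner_transOp_le_inner_self h' f))]
    at this
  linarith

omit [IsProbabilityMeasure μ] [IsMarkovKernel κ] in
lemma rightGap_le_of_dirichletForm_le {κ' : Kernel E E}
    (hle : ∀ f : E → ℝ, MemLp f 2 μ → dirichletForm μ κ f ≤ dirichletForm μ κ' f) :
    rightGap μ κ ≤ rightGap μ κ' :=
  iInf_mono fun f => iInf_mono fun hf => iInf_mono fun _ => iInf_mono fun _ => hle f hf

end Operator

/-! ### Covariances along a stationary reversible chain -/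

section Chain

open scoped InnerProductSpace

variable {E : Type*} [MeasurableSpace E] {μ : Measure E} [IsProbabilityMeasure μ]
  {κ : Kernel E E} [IsMarkovKernel κ]

instance : IsProbabilityMeasure (chainLaw μ κ) := by unfold chainLaw; infer_instance

/-- The Markov property at time `n`. -/
lemma map_chainLaw_succ (n : ℕ) :
    (chainLaw μ κ).map (fun ω => (Preorder.frestrictLe n ω, ω (n + 1)))
      = (chainLaw μ κ).map (Preorder.frestrictLe n) ⊗ₘ
        (κ.comap (fun h : (Finset.Iic n → E) => h ⟨n, Finset.mem_Iic.2 le_rfl⟩)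
          (measurable_pi_apply _)) :=
  (Kernel.map_frestrictLe_trajMeasure_compProd_eq_map_trajMeasure (X := fun _ => E)).symm

omit [IsProbabilityMeasure μ] in
lemma measurePreserving_eval_zero_chainLaw :
    MeasurePreserving (fun ω : ℕ → E => ω 0) (chainLaw μ κ) μ := by
  refine ⟨measurable_pi_apply 0, ?_⟩
  have h : (chainLaw μ κ).map (Preorder.frestrictLe (π := fun _ => E) 0)
      = μ.map (MeasurableEquiv.piUnique (fun _ : Finset.Iic 0 => E)).symm := by
    rw [chainLaw, Kernel.trajMeasure, Measure.map_comp _ _ (by fun_prop),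
      Kernel.traj_map_frestrictLe, Kernel.partialTraj_self]
    exact Measure.id_comp
  have h2 : (fun ω : ℕ → E => ω 0) = (fun x : Finset.Iic 0 → E => x ⟨0, by simp⟩)
      ∘ Preorder.frestrictLe (π := fun _ => E) 0 := rfl
  rw [h2, ← Measure.map_map (by fun_prop) (by fun_prop), h,
    Measure.map_map (by fun_prop) (by fun_prop)]
  exact Measure.map_id

lemma measurePreserving_eval_chainLaw (h : κ.IsReversible μ) (n : ℕ) :
    MeasurePreserving (fun ω : ℕ → E => ω n) (chainLaw μ κ) μ := by
  induction n with
  | zero => exact measurePreserving_eval_zero_chainLaw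
  | succ n ih =>
    refine ⟨measurable_pi_apply _, ?_⟩
    ext s hs
    have h1 : (chainLaw μ κ).map (fun ω : ℕ → E => ω (n + 1)) s
        = (chainLaw μ κ).map (fun ω => (Preorder.frestrictLe (π := fun _ => E) n ω, ω (n + 1)))
          (Set.univ ×ˢ s) := by
      rw [Measure.map_apply (measurable_pi_apply _) hs,
        Measure.map_apply (by fun_prop) (MeasurableSet.univ.prod hs)]
      congr 1; ext ω; simp
    rw [h1, map_chainLaw_succ, Measure.compProd_apply_prod MeasurableSet.univ hs,
      Measure.restrict_univ, lintegral_map (Kernel.measurable_coe _ hs) (by fun_prop)]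
    have h2 : ∫⁻ ω, κ (ω n) s ∂(chainLaw μ κ) = μ s := by
      rw [ih.lintegral_comp (κ.measurable_coe hs)]
      have := h MeasurableSet.univ hs
      simpa using this
    exact h2

lemma memLp_eval_chainLaw (h : κ.IsReversible μ) {f : E → ℝ} (hf : MemLp f 2 μ) (n : ℕ) :
    MemLp (fun ω : ℕ → E => f (ω n)) 2 (chainLaw μ κ) :=
  hf.comp_measurePreserving (measurePreserving_eval_chainLaw h n)

lemma integral_mul_eval_succ (h : κ.IsReversible μ) {f g : E → ℝ} (hf : MemLp f 2 μ)
    (hg : MemLp g 2 μ) {i n : ℕ} (hin : i ≤ n) :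
    ∫ ω, f (ω i) * g (ω (n + 1)) ∂(chainLaw μ κ)
      = ∫ ω, f (ω i) * ∫ y, g y ∂(κ (ω n)) ∂(chainLaw μ κ) := by
  let F : (Finset.Iic n → E) × E → ℝ := fun p => f (p.1 ⟨i, Finset.mem_Iic.2 hin⟩) * g p.2
  let R : (ℕ → E) → (Finset.Iic n → E) × E :=
    fun ω => (Preorder.frestrictLe (π := fun _ => E) n ω, ω (n + 1))
  have hR : Measurable R := by fun_prop
  have hi : MeasurePreserving (fun p : (Finset.Iic n → E) × E => p.1 ⟨i, Finset.mem_Iic.2 hin⟩)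
      ((chainLaw μ κ).map R) μ :=
    ⟨by fun_prop, by
      rw [Measure.map_map (by fun_prop) hR]
      exact (measurePreserving_eval_chainLaw h i).map_eq⟩
  have hn : MeasurePreserving (fun p : (Finset.Iic n → E) × E => p.2)
      ((chainLaw μ κ).map R) μ :=
    ⟨by fun_prop, by
      rw [Measure.map_map (by fun_prop) hR]
      exact (measurePreserving_eval_chainLaw h (n + 1)).map_eq⟩
  have hF : Integrable F ((chainLaw μ κ).map R) :=
    (hf.comp_measurePreserving hi).integrable_mul (hg.comp_measurePreserving hn)
  have e1 : ∫ ω, f (ω i) * g (ω (n + 1)) ∂(chainLaw μ κ) = ∫ p, F p ∂((chainLaw μ κ).map R) := by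
    rw [integral_map hR.aemeasurable hF.1]
    rfl
  rw [e1]
  rw [map_chainLaw_succ n] at hF ⊢
  rw [Measure.integral_compProd hF,
    integral_map (by fun_prop) (integrable_integral_of_compProd hF).1]
  simp only [F, integral_const_mul]
  rfl

/-- The auto-covariances of a stationary chain are the matrix coefficients of the powers of the
transition operator. -/
lemma integral_mul_eval_add (h : κ.IsReversible μ) (f g : Lp ℝ 2 μ) (i n : ℕ) :
    ∫ ω, f (ω i) * g (ω (i + n)) ∂(chainLaw μ κ) = ⟪f, (transOp h ^ n) g⟫_ℝ := by
  induction n generalizing g with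
  | zero =>
    rw [pow_zero, one_apply_eq_self, inner_eq_integral]
    exact integral_comp_of_measurePreserving (g := fun x => f x * g x)
      (measurePreserving_eval_chainLaw h i)
      ((Lp.aestronglyMeasurable f).mul (Lp.aestronglyMeasurable g))
  | succ n ih =>
    rw [pow_succ, mul_apply_eq_comp, ← ih, ← add_assoc,
      integral_mul_eval_succ h (Lp.memLp f) (Lp.memLp g) (Nat.le_add_right i n)]
    refine integral_congr_ae ?_
    filter_upwards [(measurePreserving_eval_chainLaw h (i + n)).quasiMeasurePreserving.ae
      (coeFn_transOp h g)] with ω hω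
    rw [hω]

lemma integral_sq_sum_eval (h : κ.IsReversible μ) (f : Lp ℝ 2 μ) (M : ℕ) :
    ∫ ω, (∑ i ∈ Finset.range M, f (ω i)) ^ 2 ∂(chainLaw μ κ)
      = toeplitzSum (fun k => ⟪f, (transOp h ^ k) f⟫_ℝ) M := by
  have hL : ∀ i, MemLp (fun ω : ℕ → E => f (ω i)) 2 (chainLaw μ κ) :=
    memLp_eval_chainLaw h (Lp.memLp f)
  induction M with
  | zero => simp [toeplitzSum]
  | succ M ih =>
    have hS : MemLp (fun ω : ℕ → E => ∑ i ∈ Finset.range M, f (ω i)) 2 (chainLaw μ κ) :=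
      memLp_finsetSum _ fun i _ => hL i
    have e : ∀ ω : ℕ → E, (∑ i ∈ Finset.range (M + 1), f (ω i)) ^ 2
        = (∑ i ∈ Finset.range M, f (ω i)) ^ 2
          + (2 * ∑ i ∈ Finset.range M, f (ω i) * f (ω M) + f (ω M) * f (ω M)) := fun ω => by
      rw [Finset.sum_range_succ, ← Finset.sum_mul]; ring
    have hI : ∀ i j, Integrable (fun ω : ℕ → E => f (ω i) * f (ω j)) (chainLaw μ κ) :=
      fun i j => (hL i).integrable_mul (hL j)
    have hI' : Integrable (fun ω : ℕ → E => ∑ i ∈ Finset.range M, f (ω i) * f (ω M))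
        (chainLaw μ κ) := integrable_finsetSum _ fun i _ => hI i M
    have hI'' : Integrable (fun ω : ℕ → E => 2 * ∑ i ∈ Finset.range M, f (ω i) * f (ω M)
        + f (ω M) * f (ω M)) (chainLaw μ κ) := (hI'.const_mul 2).add (hI M M)
    simp only [e]
    rw [integral_add hS.integrable_sq hI'', integral_add (hI'.const_mul 2) (hI M M), integral_const_mul,
      integral_finsetSum _ fun i _ => hI i M, ih, toeplitzSum, toeplitzSum,
      Finset.sum_range_succ _ M]
    have h0 : ∫ ω, f (ω M) * f (ω M) ∂(chainLaw μ κ) = ⟪f, (transOp h ^ 0) f⟫_ℝ :=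
      integral_mul_eval_add h f f M 0
    have h1 : ∑ i ∈ Finset.range M, ∫ ω, f (ω i) * f (ω M) ∂(chainLaw μ κ)
        = ∑ k ∈ Finset.range M, ⟪f, (transOp h ^ (k + 1)) f⟫_ℝ := by
      rw [← Finset.sum_range_reflect]
      refine Finset.sum_congr rfl fun j hj => ?_
      have hj' := Finset.mem_range.1 hj
      rw [← integral_mul_eval_add h f f (M - 1 - j) (j + 1),
        show M - 1 - j + (j + 1) = M by omega]
    rw [h0, h1, Finset.sum_range_succ' _ M]
    ring

/-- The centred version of `f`, as an element of `L²`. -/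
noncomputable def centredLp {f : E → ℝ} (hf : MemLp f 2 μ) : Lp ℝ 2 μ :=
  (hf.sub (memLp_const (∫ x, f x ∂μ))).toLp _

lemma coeFn_centredLp {f : E → ℝ} (hf : MemLp f 2 μ) :
    centredLp hf =ᵐ[μ] fun x => f x - ∫ x, f x ∂μ :=
  MemLp.coeFn_toLp _

lemma integral_eval_chainLaw (h : κ.IsReversible μ) {f : E → ℝ} (hf : MemLp f 2 μ) (i : ℕ) :
    ∫ ω, f (ω i) ∂(chainLaw μ κ) = ∫ x, f x ∂μ :=
  integral_comp_of_measurePreserving (measurePreserving_eval_chainLaw h i) hf.1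

lemma scaledVariance_eq (h : κ.IsReversible μ) {f : E → ℝ} (hf : MemLp f 2 μ) (M : ℕ) :
    scaledVariance μ κ f M = ENNReal.ofReal ((M : ℝ)⁻¹ *
      toeplitzSum (fun k => ⟪centredLp hf, (transOp h ^ k) (centredLp hf)⟫_ℝ) M) := by
  have hL := memLp_eval_chainLaw h hf
  have hS : MemLp (fun ω : ℕ → E => (Real.sqrt M)⁻¹ * ∑ i ∈ Finset.range M, f (ω i)) 2
      (chainLaw μ κ) := (memLp_finsetSum _ fun i _ => hL i).const_mul _
  have hmean : ∫ ω, (Real.sqrt M)⁻¹ * ∑ i ∈ Finset.range M, f (ω i) ∂(chainLaw μ κ)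
      = (Real.sqrt M)⁻¹ * ∑ i ∈ Finset.range M, ∫ x, f x ∂μ := by
    rw [integral_const_mul, integral_finsetSum _ fun i _ => (hL i).integrable one_le_two]
    simp only [integral_eval_chainLaw h hf]
  rw [scaledVariance, ← ofReal_variance hS, variance_eq_integral hS.1.aemeasurable, hmean,
    ← integral_sq_sum_eval h, ← integral_const_mul]
  congr 1
  refine integral_congr_ae ?_
  have hae : ∀ᵐ ω ∂(chainLaw μ κ), ∀ i, centredLp hf (ω i) = f (ω i) - ∫ x, f x ∂μ :=
    ae_all_iff.2 fun i =>
      (measurePreserving_eval_chainLaw h i).quasiMeasurePreserving.ae (coeFn_centredLp hf)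
  filter_upwards [hae] with ω hω
  simp only [hω]
  rw [← mul_sub, ← Finset.sum_sub_distrib, mul_pow, inv_pow, Real.sq_sqrt (Nat.cast_nonneg M)]

lemma autoCov_eq (h : κ.IsReversible μ) {f : E → ℝ} (hf : MemLp f 2 μ) :
    autoCov μ κ f = ⟪centredLp hf, transOp h (centredLp hf)⟫_ℝ := by
  have := integral_mul_eval_add h (centredLp hf) (centredLp hf) 0 1
  rw [pow_one] at this
  rw [← this, autoCov, covariance]
  refine integral_congr_ae ?_
  filter_upwards [(measurePreserving_eval_chainLaw h 0).quasiMeasurePreserving.ae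
      (coeFn_centredLp hf), (measurePreserving_eval_chainLaw h (0 + 1)).quasiMeasurePreserving.ae
      (coeFn_centredLp hf)] with ω h0 h1
  rw [h0, h1, integral_eval_chainLaw h hf, integral_eval_chainLaw h hf]

lemma tendsto_scaledVariance (h : κ.IsReversible μ) {f : E → ℝ} (hf : MemLp f 2 μ) :
    Tendsto (scaledVariance μ κ f) atTop (𝓝 (asymVar μ κ f)) := by
  obtain ⟨L, hL⟩ := exists_tendsto_toeplitzSum_inner_pow (transOp_isSymmetric h)
    (norm_transOp_le h) (centredLp hf)
  exact tendsto_nhds_limUnder ⟨L, hL.congr fun M => (scaledVariance_eq h hf M).symm⟩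

variable {κ' : Kernel E E} [IsMarkovKernel κ']

lemma autoCov_le_of_dirichletForm_le (h : κ.IsReversible μ) (h' : κ'.IsReversible μ)
    (hle : ∀ f : E → ℝ, MemLp f 2 μ → dirichletForm μ κ f ≤ dirichletForm μ κ' f)
    {f : E → ℝ} (hf : MemLp f 2 μ) : autoCov μ κ' f ≤ autoCov μ κ f := by
  rw [autoCov_eq h hf, autoCov_eq h' hf]
  exact inner_transOp_le_of_dirichletForm_le h h' hle _

/-- The Peskun-Tierney comparison: a larger Dirichlet form gives a smaller asymptotic variance. -/
lemma asymVar_le_of_dirichletForm_le (h : κ.IsReversible μ) (h' : κ'.IsReversible μ)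
    (hle : ∀ f : E → ℝ, MemLp f 2 μ → dirichletForm μ κ f ≤ dirichletForm μ κ' f)
    {f : E → ℝ} (hf : MemLp f 2 μ) : asymVar μ κ' f ≤ asymVar μ κ f :=
  le_of_tendsto_toeplitzSum_inner_pow (transOp_isSymmetric h) (norm_transOp_le h')
    (norm_transOp_le h) (inner_transOp_le_of_dirichletForm_le h h' hle) (centredLp hf)
    ((tendsto_scaledVariance h' hf).congr (scaledVariance_eq h' hf))
    ((tendsto_scaledVariance h hf).congr (scaledVariance_eq h hf))

end Chain

/-! ### Acceptance ratios -/

section AccRatio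

variable {Z : Type*} [MeasurableSpace Z] (m₁ m₂ : Measure Z) [IsFiniteMeasure m₁]
  [IsFiniteMeasure m₂]

lemma lintegral_eq_rnDeriv_add_left {F : Z → ℝ≥0∞} (hF : Measurable F) :
    ∫⁻ z, F z ∂m₁ = ∫⁻ z, m₁.rnDeriv (m₁ + m₂) z * F z ∂(m₁ + m₂) :=
  (lintegral_rnDeriv_mul (Measure.AbsolutelyContinuous.rfl.add_right m₂) hF.aemeasurable).symm

lemma lintegral_eq_rnDeriv_add_right {F : Z → ℝ≥0∞} (hF : Measurable F) :
    ∫⁻ z, F z ∂m₂ = ∫⁻ z, m₂.rnDeriv (m₁ + m₂) z * F z ∂(m₁ + m₂) :=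
  (lintegral_rnDeriv_mul (Measure.absolutelyContinuous_of_le
    (Measure.le_add_left le_rfl)) hF.aemeasurable).symm

lemma accRatio_of_pos {m₁ m₂ : Measure Z} {z : Z} (h₁ : 0 < m₁.rnDeriv (m₁ + m₂) z)
    (h₂ : 0 < m₂.rnDeriv (m₁ + m₂) z) :
    accRatio m₁ m₂ z = m₂.rnDeriv (m₁ + m₂) z / m₁.rnDeriv (m₁ + m₂) z :=
  Set.indicator_of_mem (s := {z | 0 < m₁.rnDeriv (m₁ + m₂) z ∧ 0 < m₂.rnDeriv (m₁ + m₂) z})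
    ⟨h₁, h₂⟩ _

lemma accRatio_of_not_pos {m₁ m₂ : Measure Z} {z : Z}
    (h : ¬(0 < m₁.rnDeriv (m₁ + m₂) z ∧ 0 < m₂.rnDeriv (m₁ + m₂) z)) : accRatio m₁ m₂ z = 0 :=
  Set.indicator_of_notMem
    (s := {z | 0 < m₁.rnDeriv (m₁ + m₂) z ∧ 0 < m₂.rnDeriv (m₁ + m₂) z}) h _

/-- On the set where the ratio is positive, `m₂` has density `accRatio m₁ m₂` with respect
to `m₁`. -/
lemma lintegral_indicator_accRatio_pos {G : Z → ℝ≥0∞} (hG : Measurable G) :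
    ∫⁻ z, {z | 0 < accRatio m₁ m₂ z}.indicator G z ∂m₂ = ∫⁻ z, accRatio m₁ m₂ z * G z ∂m₁ := by
  have hr := measurable_accRatio m₁ m₂
  rw [lintegral_eq_rnDeriv_add_left m₁ m₂ (F := fun z => accRatio m₁ m₂ z * G z) (hr.mul hG),
    lintegral_eq_rnDeriv_add_right m₁ m₂
    (hG.indicator (measurableSet_lt measurable_const hr))]
  refine lintegral_congr_ae ?_
  filter_upwards [Measure.rnDeriv_lt_top m₁ (m₁ + m₂)] with z h1
  by_cases h : 0 < m₁.rnDeriv (m₁ + m₂) z ∧ 0 < m₂.rnDeriv (m₁ + m₂) z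
  · have hz : z ∈ {z | 0 < accRatio m₁ m₂ z} := by
      rw [Set.mem_ofPred_eq, accRatio_of_pos h.1 h.2]
      exact ENNReal.div_pos h.2.ne' h1.ne
    rw [Set.indicator_of_mem hz, accRatio_of_pos h.1 h.2, ← mul_assoc,
      ENNReal.mul_div_cancel h.1.ne' h1.ne]
  · have h0 := accRatio_of_not_pos h
    have hz : z ∉ {z | 0 < accRatio m₁ m₂ z} := by simp [h0]
    rw [Set.indicator_of_notMem hz, h0]
    simp

omit [IsFiniteMeasure m₁] in
lemma ae_accRatio_lt_top : ∀ᵐ z ∂m₁, accRatio m₁ m₂ z < ∞ := by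
  refine (Measure.absolutelyContinuous_of_le (Measure.le_add_right le_rfl) :
    m₁ ≪ m₁ + m₂).ae_le ?_
  filter_upwards [Measure.rnDeriv_lt_top m₂ (m₁ + m₂)] with z h2
  by_cases h : 0 < m₁.rnDeriv (m₁ + m₂) z ∧ 0 < m₂.rnDeriv (m₁ + m₂) z
  · rw [accRatio_of_pos h.1 h.2]
    exact ENNReal.div_lt_top h2.ne h.1.ne'
  · simp [accRatio_of_not_pos h]

/-- The ratio is the density of the absolutely continuous part of `m₂`, so it dominates every `g`
with `g m₁ ≤ m₂`. -/
lemma le_accRatio_of_setLIntegral_le {g : Z → ℝ≥0∞} (hg : Measurable g)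
    (h : ∀ s, MeasurableSet s → ∫⁻ z in s, g z ∂m₁ ≤ m₂ s) : g ≤ᵐ[m₁] accRatio m₁ m₂ := by
  have hae : ∀ᵐ z ∂(m₁ + m₂),
      m₁.rnDeriv (m₁ + m₂) z * g z ≤ m₂.rnDeriv (m₁ + m₂) z := by
    refine ae_le_of_forall_setLIntegral_le_of_sigmaFinite
      ((Measure.measurable_rnDeriv _ _).mul hg) fun s hs _ => ?_
    rw [Measure.setLIntegral_rnDeriv (Measure.absolutelyContinuous_of_le
      (Measure.le_add_left le_rfl))]
    refine le_trans (le_of_eq ?_) (h s hs)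
    rw [← lintegral_indicator hs, ← lintegral_indicator hs,
      lintegral_eq_rnDeriv_add_left m₁ m₂ (hg.indicator hs)]
    refine lintegral_congr fun z => ?_
    by_cases hz : z ∈ s <;> simp [hz]
  have hac : m₁ ≪ m₁ + m₂ := Measure.absolutelyContinuous_of_le (Measure.le_add_right le_rfl)
  filter_upwards [hac.ae_le hae, hac.ae_le (Measure.rnDeriv_lt_top m₁ (m₁ + m₂)),
    Measure.rnDeriv_pos hac] with z hz h1 hpos
  by_cases h2 : 0 < m₂.rnDeriv (m₁ + m₂) z
  · rw [accRatio_of_pos hpos h2, ENNReal.le_div_iff_mul_le (Or.inl hpos.ne') (Or.inl h1.ne),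
      mul_comm]
    exact hz
  · rw [not_lt, nonpos_iff_eq_zero] at h2
    rw [h2, nonpos_iff_eq_zero, mul_eq_zero] at hz
    rw [hz.resolve_left hpos.ne']
    exact zero_le

lemma lintegral_min_accRatio_mul {F : Z → ℝ≥0∞} (hF : Measurable F) :
    ∫⁻ z, min 1 (accRatio m₁ m₂ z) * F z ∂m₁
      = ∫⁻ z, min (m₁.rnDeriv (m₁ + m₂) z) (m₂.rnDeriv (m₁ + m₂) z) * F z ∂(m₁ + m₂) := by
  rw [lintegral_eq_rnDeriv_add_left m₁ m₂ (F := fun z => min 1 (accRatio m₁ m₂ z) * F z)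
    ((measurable_const.min (measurable_accRatio m₁ m₂)).mul hF)]
  refine lintegral_congr_ae ?_
  filter_upwards [Measure.rnDeriv_lt_top m₁ (m₁ + m₂)] with z h1
  rw [← mul_assoc]
  congr 1
  by_cases h : 0 < m₁.rnDeriv (m₁ + m₂) z ∧ 0 < m₂.rnDeriv (m₁ + m₂) z
  · rw [accRatio_of_pos h.1 h.2, mul_min, mul_one, ENNReal.mul_div_cancel h.1.ne' h1.ne]
  · rw [accRatio_of_not_pos h]
    simp only [not_and_or, not_lt, nonpos_iff_eq_zero] at h
    rcases h with h | h <;> simp [h]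

/-- Accepting with probability `min 1 (dm₂/dm₁)` turns `m₁` into the infimum of `m₁` and `m₂`, which
is symmetric if an involution exchanges the two measures. -/
lemma lintegral_min_accRatio_comp (σ : Z ≃ᵐ Z) (hσ : ∀ z, σ (σ z) = z) (hm : m₂ = m₁.map σ)
    {F : Z → ℝ≥0∞} (hF : Measurable F) :
    ∫⁻ z, min 1 (accRatio m₁ m₂ z) * F (σ z) ∂m₁ = ∫⁻ z, min 1 (accRatio m₁ m₂ z) * F z ∂m₁ := by
  have hm' : m₂.map σ = m₁ := by
    rw [hm, Measure.map_map σ.measurable σ.measurable]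
    convert Measure.map_id
    exact funext hσ
  have hν : (m₁ + m₂).map σ = m₁ + m₂ := by
    rw [Measure.map_add _ _ σ.measurable, hm', ← hm, add_comm]
  rw [lintegral_min_accRatio_mul m₁ m₂ (F := fun z => F (σ z)) (hF.comp σ.measurable),
    lintegral_min_accRatio_mul m₁ m₂ hF]
  conv_rhs => rw [← hν]
  rw [lintegral_map ?_ σ.measurable]
  swap
  · rw [hν]
    exact ((Measure.measurable_rnDeriv _ _).min (Measure.measurable_rnDeriv _ _)).mul hF
  have h1 := σ.measurableEmbedding.rnDeriv_map m₁ (m₁ + m₂)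
  have h2 := σ.measurableEmbedding.rnDeriv_map m₂ (m₁ + m₂)
  rw [hν, ← hm] at h1
  rw [hν, hm'] at h2
  rw [hν]
  refine lintegral_congr_ae ?_
  filter_upwards [h1, h2] with z h1 h2
  rw [h1, h2, min_comm]

end AccRatio

/-! ### Accept/reject kernels -/

section AcceptReject

variable {X Z : Type*} [MeasurableSpace X] [MeasurableSpace Z] {π : Measure X}

lemma lintegral_compProd_acceptReject [SFinite π] (Q : Kernel X Z) [IsMarkovKernel Q]
    {proj : Z → X} (hproj : Measurable proj) {r : X × Z → ℝ≥0∞} (hr : Measurable r)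
    {F : X × X → ℝ≥0∞} (hF : Measurable F) :
    ∫⁻ p, F p ∂(π ⊗ₘ acceptReject Q proj hproj r hr)
      = ∫⁻ x, ∫⁻ z, min 1 (r (x, z)) * F (x, proj z) ∂(Q x) ∂π
        + ∫⁻ x, (1 - accProb Q r x) * F (x, x) ∂π := by
  have hd : ∀ x, Measurable fun z => min 1 (r (x, z)) := fun x => by fun_prop
  have hinner : ∀ x, ∫⁻ y, F (x, y) ∂(acceptReject Q proj hproj r hr x)
      = ∫⁻ z, min 1 (r (x, z)) * F (x, proj z) ∂(Q x) + (1 - accProb Q r x) * F (x, x) := by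
    intro x
    have hFx : Measurable fun y => F (x, y) := by fun_prop
    change ∫⁻ y, F (x, y) ∂(((Q x).withDensity (fun z => min 1 (r (x, z)))).map proj
      + (1 - accProb Q r x) • Measure.dirac x) = _
    rw [lintegral_add_measure, lintegral_map hFx hproj, lintegral_smul_measure,
      lintegral_dirac' x hFx, smul_eq_mul,
      lintegral_withDensity_eq_lintegral_mul (Q x) (hd x) (g := fun z => F (x, proj z))
        (hFx.comp hproj)]
    rfl
  rw [Measure.lintegral_compProd hF]
  simp only [hinner]
  refine lintegral_add_right _ ((measurable_const.sub (measurable_accProb Q hr)).mul ?_)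
  fun_prop

lemma lintegral_compProd_halfMix [SFinite π] (κ₁ κ₂ : Kernel X X) [IsMarkovKernel κ₁]
    [IsMarkovKernel κ₂] {F : X × X → ℝ≥0∞} (hF : Measurable F) :
    ∫⁻ p, F p ∂(π ⊗ₘ halfMix κ₁ κ₂)
      = 2⁻¹ * ∫⁻ p, F p ∂(π ⊗ₘ κ₁) + 2⁻¹ * ∫⁻ p, F p ∂(π ⊗ₘ κ₂) := by
  have h₁ : Measurable fun x => ∫⁻ y, F (x, y) ∂(κ₁ x) := hF.lintegral_kernel_prod_right'
  have h₂ : Measurable fun x => ∫⁻ y, F (x, y) ∂(κ₂ x) := hF.lintegral_kernel_prod_right'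
  rw [Measure.lintegral_compProd hF, Measure.lintegral_compProd hF, Measure.lintegral_compProd hF,
    ← lintegral_const_mul _ h₁, ← lintegral_const_mul _ h₂, ← lintegral_add_left (h₁.const_mul _)]
  refine lintegral_congr fun x => ?_
  change ∫⁻ y, F (x, y) ∂((2⁻¹ : ℝ≥0∞) • κ₁ x + (2⁻¹ : ℝ≥0∞) • κ₂ x) = _
  rw [lintegral_add_measure, lintegral_smul_measure, lintegral_smul_measure]
  rfl

lemma isReversible_of_lintegral_swap [IsProbabilityMeasure π] {κ : Kernel X X} [IsMarkovKernel κ]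
    (h : ∀ F : X × X → ℝ≥0∞, Measurable F →
      ∫⁻ p, F p.swap ∂(π ⊗ₘ κ) = ∫⁻ p, F p ∂(π ⊗ₘ κ)) : κ.IsReversible π := by
  refine isReversible_of_map_swap_compProd (Measure.ext_of_lintegral _ fun F hF => ?_)
  rw [lintegral_map hF measurable_swap, h F hF]

lemma dirichletForm_congr_ae [IsProbabilityMeasure π] {κ : Kernel X X} [IsMarkovKernel κ]
    (h : κ.IsReversible π) {f g : X → ℝ} (hfg : f =ᵐ[π] g) :
    dirichletForm π κ f = dirichletForm π κ g := by
  unfold dirichletForm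
  congr 1
  refine lintegral_congr_ae ?_
  filter_upwards [(measurePreserving_fst_compProd (μ := π) (κ := κ)).quasiMeasurePreserving.ae hfg,
    (measurePreserving_snd_compProd h).quasiMeasurePreserving.ae hfg] with z h1 h2
  rw [h1, h2]

end AcceptReject

/-! ### The Metropolis-Hastings kernel -/

section MH

variable {X : Type*} [MeasurableSpace X] (π : Measure X) [IsProbabilityMeasure π]
  (q : Kernel X X) [IsMarkovKernel q]

lemma lintegral_compProd_mhKernel {F : X × X → ℝ≥0∞} (hF : Measurable F) :
    ∫⁻ p, F p ∂(π ⊗ₘ mhKernel π q)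
      = ∫⁻ p, min 1 (mhRatio π q p) * F p ∂(π ⊗ₘ q)
        + ∫⁻ x, (1 - accProb q (mhRatio π q) x) * F (x, x) ∂π := by
  rw [mhKernel, lintegral_compProd_acceptReject q measurable_id (measurable_mhRatio π q) hF,
    Measure.lintegral_compProd (f := fun p => min 1 (mhRatio π q p) * F p)
      ((measurable_const.min (measurable_mhRatio π q)).mul hF)]
  rfl

lemma mhKernel_isReversible : (mhKernel π q).IsReversible π := by
  refine isReversible_of_lintegral_swap fun F hF => ?_
  have : IsFiniteMeasure ((π ⊗ₘ q).map Prod.swap) := Measure.isFiniteMeasure_map _ _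
  rw [lintegral_compProd_mhKernel π q (F := fun p => F p.swap) (hF.comp measurable_swap),
    lintegral_compProd_mhKernel π q hF]
  congr 1
  exact lintegral_min_accRatio_comp (π ⊗ₘ q) ((π ⊗ₘ q).map Prod.swap) MeasurableEquiv.prodComm
    (fun _ => rfl) rfl hF

lemma dirichletForm_mhKernel {f : X → ℝ} (hf : Measurable f) :
    dirichletForm π (mhKernel π q) f
      = 2⁻¹ * ∫⁻ p, min 1 (mhRatio π q p) * ENNReal.ofReal ((f p.1 - f p.2) ^ 2) ∂(π ⊗ₘ q) := by
  rw [dirichletForm, lintegral_compProd_mhKernel π q (by fun_prop)]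
  simp

end MH

/-! ### Product measures with one distinguished coordinate -/

lemma lintegral_pi_insertNth {U : Type*} [MeasurableSpace U] {n : ℕ}
    (ν : Fin (n + 1) → Measure U) [∀ i, IsProbabilityMeasure (ν i)] (k : Fin (n + 1))
    {F : (Fin (n + 1) → U) → ℝ≥0∞} (hF : Measurable F) :
    ∫⁻ u, F u ∂(Measure.pi ν)
      = ∫⁻ v, ∫⁻ w, F (k.insertNth v w) ∂(Measure.pi fun j => ν (k.succAbove j)) ∂(ν k) := by
  have hm := (measurePreserving_piFinSuccAbove ν k).symm
  rw [← hm.lintegral_comp hF, lintegral_prod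
    (fun z => F ((MeasurableEquiv.piFinSuccAbove (fun _ => U) k).symm z))
    (hF.comp hm.measurable).aemeasurable]
  rfl

lemma lintegral_pi_succAbove {U : Type*} [MeasurableSpace U] {n : ℕ}
    (ν : Measure U) [IsProbabilityMeasure ν] (k : Fin (n + 1))
    {F : (Fin n → U) → ℝ≥0∞} (hF : Measurable F) :
    ∫⁻ u : Fin (n + 1) → U, F (fun j => u (k.succAbove j)) ∂(Measure.pi fun _ => ν)
      = ∫⁻ w, F w ∂(Measure.pi fun _ => ν) := by
  rw [lintegral_pi_insertNth (fun _ => ν) k (F := fun u => F fun j => u (k.succAbove j))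
    (by fun_prop)]
  simp

lemma sum_sum_succAbove {n : ℕ} (ρ : Fin (n + 1) → ℝ≥0∞) :
    ∑ j : Fin (n + 1), ∑ i : Fin n, ρ (j.succAbove i) = n * ∑ i, ρ i := by
  have h : ∀ j : Fin (n + 1), ∑ i : Fin n, ρ (j.succAbove i)
      = ∑ i, if i = j then 0 else ρ i := fun j => by
    rw [Fin.sum_univ_succAbove _ j]; simp
  simp only [h]
  rw [Finset.sum_comm, Finset.mul_sum]
  refine Finset.sum_congr rfl fun i _ => ?_
  rw [Fin.sum_univ_succAbove _ i]
  simp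

/-! ### The averaged acceptance probability -/

section Averaging

variable {X U : Type*} [MeasurableSpace X] [MeasurableSpace U] (π : Measure X)
  (q : Kernel X X) (Q : Kernel (X × X) U) [IsMarkovKernel Q] (φ : U → U) (hφ : Measurable φ)

/-- The probability that the first mechanism accepts a proposed move from `x` to `y`, averaged over
the auxiliary variables. -/
noncomputable def avgAccProb (N : ℕ) (p : X × X) : ℝ≥0∞ :=
  ∫⁻ u, min 1 (avgRatio π q Q φ hφ N p.1 p.2 u) ∂(Measure.pi fun _ : Fin N => Q p)

omit [IsMarkovKernel Q] in
lemma measurable_avgRatio_prod (N : ℕ) : Measurable fun p : (X × X) × (Fin N → U) =>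
    avgRatio π q Q φ hφ N p.1.1 p.1.2 p.2 :=
  (measurable_avgRatio π q Q φ hφ N).comp
    (g := fun p : X × X × (Fin N → U) => avgRatio π q Q φ hφ N p.1 p.2.1 p.2.2)
    (f := fun p : (X × X) × (Fin N → U) => (p.1.1, p.1.2, p.2)) (by fun_prop)

omit [IsMarkovKernel Q] in
lemma measurable_avgRatio_right (N : ℕ) (x y : X) :
    Measurable (avgRatio π q Q φ hφ N x y) :=
  (measurable_avgRatio_prod π q Q φ hφ N).comp (measurable_prodMk_left (x := (x, y)))

lemma measurable_avgAccProb (N : ℕ) : Measurable (avgAccProb π q Q φ hφ N) :=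
  Measurable.lintegral_kernel_prod_right' (κ := piKernel fun _ : Fin N => Q)
    (f := fun p : (X × X) × (Fin N → U) => min 1 (avgRatio π q Q φ hφ N p.1.1 p.1.2 p.2))
    (measurable_const.min (measurable_avgRatio_prod π q Q φ hφ N))

/-- An average of `n + 1` ratios is the average of its leave-one-out averages, and `min 1` is
concave. -/
lemma avgAccProb_le_succ {n : ℕ} (hn : n ≠ 0) (p : X × X) :
    avgAccProb π q Q φ hφ n p ≤ avgAccProb π q Q φ hφ (n + 1) p := by
  have hn' : (n : ℝ≥0∞) ≠ 0 := Nat.cast_ne_zero.2 hn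
  have hc : ((n + 1 : ℕ) : ℝ≥0∞)⁻¹ * ((n + 1 : ℕ) : ℝ≥0∞) = 1 :=
    ENNReal.inv_mul_cancel (Nat.cast_ne_zero.2 n.succ_ne_zero) (ENNReal.natCast_ne_top _)
  have hA := measurable_avgRatio_right π q Q φ hφ n p.1 p.2
  have hpt : ∀ u : Fin (n + 1) → U,
      ((n + 1 : ℕ) : ℝ≥0∞)⁻¹ * ∑ j : Fin (n + 1),
          min 1 (avgRatio π q Q φ hφ n p.1 p.2 fun i => u (j.succAbove i))
        ≤ min 1 (avgRatio π q Q φ hφ (n + 1) p.1 p.2 u) := by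
    intro u
    refine le_min ?_ ?_
    · calc _ ≤ ((n + 1 : ℕ) : ℝ≥0∞)⁻¹ * ∑ j : Fin (n + 1), 1 := by
            gcongr; exact min_le_left _ _
        _ = 1 := by simpa using hc
    · calc _ ≤ ((n + 1 : ℕ) : ℝ≥0∞)⁻¹ * ∑ j : Fin (n + 1),
              avgRatio π q Q φ hφ n p.1 p.2 fun i => u (j.succAbove i) := by
            gcongr; exact min_le_right _ _
        _ = avgRatio π q Q φ hφ (n + 1) p.1 p.2 u := by
            simp only [avgRatio, div_eq_mul_inv]
            rw [← Finset.sum_mul,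
              sum_sum_succAbove (fun i => ringRatio π q Q φ hφ (p.1, (p.2, u i))),
              mul_comm (n : ℝ≥0∞), mul_assoc _ (n : ℝ≥0∞),
              ENNReal.mul_inv_cancel hn' (ENNReal.natCast_ne_top n), mul_one, mul_comm]
  calc avgAccProb π q Q φ hφ n p
      = ((n + 1 : ℕ) : ℝ≥0∞)⁻¹ * ∑ j : Fin (n + 1), avgAccProb π q Q φ hφ n p := by
        rw [Finset.sum_const, Finset.card_univ, Fintype.card_fin, nsmul_eq_mul, ← mul_assoc, hc,
          one_mul]
    _ = ∫⁻ u : Fin (n + 1) → U, ((n + 1 : ℕ) : ℝ≥0∞)⁻¹ * ∑ j : Fin (n + 1),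
          min 1 (avgRatio π q Q φ hφ n p.1 p.2 fun i => u (j.succAbove i))
            ∂(Measure.pi fun _ => Q p) := by
        have hm : ∀ j : Fin (n + 1), Measurable fun u : Fin (n + 1) → U =>
            min 1 (avgRatio π q Q φ hφ n p.1 p.2 fun i => u (j.succAbove i)) := fun j =>
          measurable_const.min (hA.comp (by fun_prop))
        rw [lintegral_const_mul _ (Finset.measurable_sum _ fun j _ => hm j),
          lintegral_finsetSum _ fun j _ => hm j]
        congr 1
        refine Finset.sum_congr rfl fun j _ => ?_
        exact (lintegral_pi_succAbove (Q p) j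
          (F := fun w => min 1 (avgRatio π q Q φ hφ n p.1 p.2 w))
          (measurable_const.min hA)).symm
    _ ≤ _ := lintegral_mono hpt

lemma avgAccProb_mono {N M : ℕ} (hN : N ≠ 0) (hNM : N ≤ M) (p : X × X) :
    avgAccProb π q Q φ hφ N p ≤ avgAccProb π q Q φ hφ M p := by
  induction M, hNM using Nat.le_induction with
  | base => exact le_rfl
  | succ M hM ih => exact ih.trans (avgAccProb_le_succ π q Q φ hφ (by omega) p)

lemma avgAccProb_le_min {N : ℕ} (hN : N ≠ 0) (p : X × X) :
    avgAccProb π q Q φ hφ N p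
      ≤ min 1 (∫⁻ u, ringRatio π q Q φ hφ (p.1, (p.2, u)) ∂(Q p)) := by
  have hr : Measurable fun u => ringRatio π q Q φ hφ (p.1, (p.2, u)) :=
    (measurable_ringRatio π q Q φ hφ).comp (by fun_prop)
  refine le_min ?_ ?_
  · refine (lintegral_mono fun u => min_le_left _ _).trans ?_
    simp
  · refine (lintegral_mono fun u => min_le_right _ _).trans (le_of_eq ?_)
    simp only [avgRatio, div_eq_mul_inv]
    have hri : ∀ i : Fin N, Measurable fun u : Fin N → U =>
        ringRatio π q Q φ hφ (p.1, (p.2, u i)) := fun i => hr.comp (measurable_pi_apply i)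
    rw [lintegral_mul_const _ (Finset.measurable_sum _ fun i _ => hri i),
      lintegral_finsetSum _ fun i _ => hri i]
    have h : ∀ i : Fin N, ∫⁻ u : Fin N → U, ringRatio π q Q φ hφ (p.1, (p.2, u i))
        ∂(Measure.pi fun _ => Q p) = ∫⁻ v, ringRatio π q Q φ hφ (p.1, (p.2, v)) ∂(Q p) :=
      fun i => (measurePreserving_eval (fun _ : Fin N => Q p) i).lintegral_comp hr
    simp only [h]
    rw [Finset.sum_const, Finset.card_univ, Fintype.card_fin, nsmul_eq_mul, mul_comm, ← mul_assoc,
      ENNReal.inv_mul_cancel (Nat.cast_ne_zero.2 hN) (ENNReal.natCast_ne_top N), one_mul]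

variable [IsProbabilityMeasure π] [IsMarkovKernel q]

instance : IsFiniteMeasure ((π ⊗ₘ (q ⊗ₖ barKernel Q φ hφ)).map
    fun p : X × (X × U) => (p.2.1, (p.1, p.2.2))) := Measure.isFiniteMeasure_map _ _

/-- The estimated ratio has mean at most the Metropolis-Hastings ratio. There may be no equality:
mass is lost where `Q̄_{y,x}` is singular with respect to `Q_{x,y}`. -/
lemma lintegral_ringRatio_le : ∀ᵐ p ∂(π ⊗ₘ q),
    ∫⁻ u, ringRatio π q Q φ hφ (p.1, (p.2, u)) ∂(Q p) ≤ mhRatio π q p := by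
  have hr := measurable_ringRatio π q Q φ hφ
  have : IsFiniteMeasure ((π ⊗ₘ q).map Prod.swap) := Measure.isFiniteMeasure_map _ _
  have hgm : Measurable fun p : X × X => ∫⁻ u, ringRatio π q Q φ hφ (p.1, (p.2, u)) ∂(Q p) :=
    Measurable.lintegral_kernel_prod_right' (κ := Q)
      (f := fun p : (X × X) × U => ringRatio π q Q φ hφ (p.1.1, (p.1.2, p.2)))
      (hr.comp (by fun_prop))
  refine le_accRatio_of_setLIntegral_le (π ⊗ₘ q) ((π ⊗ₘ q).map Prod.swap) hgm fun s hs => ?_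
  -- The integral over `s` is the mass that `m₂` gives to a part of the cylinder over `s`.
  let G : X × (X × U) → ℝ≥0∞ := fun z => s.indicator 1 (z.1, z.2.1)
  have hG : Measurable G := (measurable_one.indicator hs).comp (by fun_prop)
  have e1 : ∫⁻ p in s, ∫⁻ u, ringRatio π q Q φ hφ (p.1, (p.2, u)) ∂(Q p) ∂(π ⊗ₘ q)
      = ∫⁻ z, ringRatio π q Q φ hφ z * G z ∂(π ⊗ₘ (q ⊗ₖ Q)) := by
    rw [← lintegral_indicator hs, Measure.lintegral_compProd (hgm.indicator hs),
      Measure.lintegral_compProd (f := fun z => ringRatio π q Q φ hφ z * G z) (hr.mul hG)]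
    refine lintegral_congr fun x => ?_
    rw [Kernel.lintegral_compProd q Q x (f := fun z => ringRatio π q Q φ hφ (x, z) * G (x, z))
      ((hr.mul hG).comp measurable_prodMk_left)]
    refine lintegral_congr fun y => ?_
    by_cases hxy : (x, y) ∈ s <;> simp [G, hxy]
  rw [e1]
  refine (lintegral_indicator_accRatio_pos (π ⊗ₘ (q ⊗ₖ Q)) _ hG).symm.trans_le ?_
  refine (lintegral_mono fun z => Set.indicator_le_self _ _ z).trans ?_
  rw [lintegral_map hG (by fun_prop), Measure.map_apply measurable_swap hs,
    ← lintegral_indicator_one (measurable_swap hs),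
    Measure.lintegral_compProd (f := fun z : X × (X × U) => G (z.2.1, (z.1, z.2.2)))
      (hG.comp (by fun_prop)),
    Measure.lintegral_compProd (measurable_one.indicator (measurable_swap hs))]
  refine lintegral_mono fun x => ?_
  rw [Kernel.lintegral_compProd q _ x (f := fun z : X × U => G (z.1, (x, z.2))) (by fun_prop)]
  refine lintegral_mono fun y => ?_
  by_cases hxy : (y, x) ∈ s <;> simp [G, hxy]

lemma avgAccProb_le_mhRatio {N : ℕ} (hN : N ≠ 0) :
    ∀ᵐ p ∂(π ⊗ₘ q), avgAccProb π q Q φ hφ N p ≤ min 1 (mhRatio π q p) := by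
  filter_upwards [lintegral_ringRatio_le π q Q φ hφ] with p hp
  exact (avgAccProb_le_min π q Q φ hφ hN p).trans (min_le_min_left _ hp)

/-! ### The two mechanisms -/

lemma lintegral_proposal₁ (N : ℕ) [NeZero N] {F : X × X → ℝ≥0∞} (hF : Measurable F) :
    ∫⁻ x, ∫⁻ z, min 1 (ratio₁ π q Q φ hφ N (x, z)) * F (x, z.1) ∂(proposal₁ π q Q φ hφ N x) ∂π
      = ∫⁻ p, avgAccProb π q Q φ hφ N p * F p ∂(π ⊗ₘ q) := by
  have hm : Measurable fun p : X × (X × ((Fin N → U) × Fin N)) =>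
      min 1 (ratio₁ π q Q φ hφ N p) * F (p.1, p.2.1) :=
    (measurable_const.min (measurable_ratio₁ π q Q φ hφ N)).mul (by fun_prop)
  rw [Measure.lintegral_compProd (f := fun p => avgAccProb π q Q φ hφ N p * F p)
    ((measurable_avgAccProb π q Q φ hφ N).mul hF)]
  refine lintegral_congr fun x => ?_
  rw [proposal₁, Kernel.lintegral_compProd _ _ x
    (f := fun z => min 1 (ratio₁ π q Q φ hφ N (x, z)) * F (x, z.1))
    (hm.comp measurable_prodMk_left)]
  refine lintegral_congr fun y => ?_
  rw [Kernel.lintegral_compProd _ _ (x, y)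
    (f := fun z => min 1 (ratio₁ π q Q φ hφ N (x, (y, z))) * F (x, y))
    (hm.comp (f := fun z => (x, (y, z))) (by fun_prop))]
  simp only [ratio₁, lintegral_const, measure_univ, mul_one]
  exact lintegral_mul_const _
    (measurable_const.min (measurable_avgRatio_right π q Q φ hφ N x y))

lemma ae_avgRatio_lt_top (N : ℕ) [NeZero N] : ∀ᵐ x ∂π, ∀ᵐ y ∂(q x),
    ∀ᵐ u ∂(Measure.pi fun _ : Fin N => Q (x, y)), avgRatio π q Q φ hφ N x y u < ∞ := by
  have h := Measure.ae_ae_of_ae_compProd (ae_accRatio_lt_top (π ⊗ₘ (q ⊗ₖ Q))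
    ((π ⊗ₘ (q ⊗ₖ barKernel Q φ hφ)).map fun p : X × (X × U) => (p.2.1, (p.1, p.2.2))))
  filter_upwards [h] with x hx
  filter_upwards [Kernel.ae_ae_of_ae_compProd hx] with y hy
  have hall : ∀ᵐ u ∂(Measure.pi fun _ : Fin N => Q (x, y)), ∀ i,
      ringRatio π q Q φ hφ (x, (y, u i)) < ∞ :=
    ae_all_iff.2 fun i =>
      (measurePreserving_eval (fun _ : Fin N => Q (x, y)) i).quasiMeasurePreserving.ae hy
  filter_upwards [hall] with u hu
  exact ENNReal.div_lt_top (ENNReal.sum_lt_top.2 fun i _ => hu i).ne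
    (Nat.cast_ne_zero.2 (NeZero.ne N))

/-- The change of measure behind the second mechanism: given the index `k`, reversing the move
and replacing the law of `u k` by `Q_{x,y}` costs the factor `r̊_{u k}(x, y)`. -/
lemma lintegral_aux₂Coord {N : ℕ} (k : Fin N) {H : (X × X) × (Fin N → U) → ℝ≥0∞}
    (hH : Measurable H) :
    ∫⁻ x, ∫⁻ y, ∫⁻ u,
        {u : Fin N → U | 0 < ringRatio π q Q φ hφ (y, (x, u k))}.indicator
          (fun u => H ((y, x), u)) u
        ∂(Measure.pi fun i => aux₂Coord Q φ hφ k i (x, y)) ∂(q x) ∂π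
      = ∫⁻ x, ∫⁻ y, ∫⁻ u, ringRatio π q Q φ hφ (x, (y, u k)) * H ((x, y), u)
        ∂(Measure.pi fun _ : Fin N => Q (x, y)) ∂(q x) ∂π := by
  obtain ⟨n, rfl⟩ : ∃ n, N = n + 1 := ⟨N - 1, by have := k.pos; omega⟩
  have hr := measurable_ringRatio π q Q φ hφ
  -- `K` integrates out the coordinates other than `k`.
  let K : X × (X × U) → ℝ≥0∞ := fun z =>
    ∫⁻ w, H ((z.1, z.2.1), k.insertNth z.2.2 w) ∂(Measure.pi fun _ : Fin n => Q (z.1, z.2.1))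
  have hins : Measurable fun p : U × (Fin n → U) => (k.insertNth p.1 p.2 : Fin (n + 1) → U) :=
    (MeasurableEquiv.piFinSuccAbove (fun _ => U) k).symm.measurable
  have hK : Measurable K :=
    Measurable.lintegral_kernel_prod_right'
      (κ := (piKernel fun _ : Fin n => Q).comap (fun z : X × (X × U) => (z.1, z.2.1))
        (by fun_prop))
      (f := fun p : (X × (X × U)) × (Fin n → U) =>
        H ((p.1.1, p.1.2.1), k.insertNth p.1.2.2 p.2))
      (hH.comp ((by fun_prop : Measurable fun p : (X × (X × U)) × (Fin n → U) =>
        (p.1.1, p.1.2.1)).prodMk (hins.comp (f := fun p : (X × (X × U)) × (Fin n → U) =>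
          (p.1.2.2, p.2)) (by fun_prop))))
  have hKi : Measurable ({z | 0 < ringRatio π q Q φ hφ z}.indicator K) :=
    hK.indicator (measurableSet_lt measurable_const hr)
  have key := lintegral_indicator_accRatio_pos (π ⊗ₘ (q ⊗ₖ Q))
    ((π ⊗ₘ (q ⊗ₖ barKernel Q φ hφ)).map fun p : X × (X × U) => (p.2.1, (p.1, p.2.2))) hK
  change ∫⁻ z, {z | 0 < ringRatio π q Q φ hφ z}.indicator K z ∂_
    = ∫⁻ z, ringRatio π q Q φ hφ z * K z ∂_ at key
  rw [lintegral_map hKi (by fun_prop), Measure.lintegral_compProd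
      (f := fun a : X × (X × U) =>
        {z | 0 < ringRatio π q Q φ hφ z}.indicator K (a.2.1, (a.1, a.2.2)))
      (hKi.comp (by fun_prop)),
    Measure.lintegral_compProd (f := fun z => ringRatio π q Q φ hφ z * K z) (hr.mul hK)] at key
  convert key using 1
  · refine lintegral_congr fun x => ?_
    rw [Kernel.lintegral_compProd q _ x
      (f := fun z : X × U => {z | 0 < ringRatio π q Q φ hφ z}.indicator K (z.1, (x, z.2)))
      (hKi.comp (by fun_prop))]
    refine lintegral_congr fun y => ?_
    have hm : Measurable ({u : Fin (n + 1) → U |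
        0 < ringRatio π q Q φ hφ (y, (x, u k))}.indicator (fun u => H ((y, x), u))) :=
      (hH.comp measurable_prodMk_left).indicator
        (measurableSet_lt measurable_const (hr.comp (by fun_prop)))
    rw [lintegral_pi_insertNth (fun i => aux₂Coord Q φ hφ k i (x, y)) k hm]
    have h1 : aux₂Coord Q φ hφ k k = barKernel Q φ hφ := if_pos rfl
    have h2 : ∀ j, aux₂Coord Q φ hφ k (k.succAbove j) = Q.comap Prod.swap measurable_swap :=
      fun j => if_neg (Fin.succAbove_ne k j)
    simp only [h1, h2]
    refine lintegral_congr fun v => ?_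
    by_cases hv : 0 < ringRatio π q Q φ hφ (y, (x, v))
    · rw [Set.indicator_of_mem (s := {z | 0 < ringRatio π q Q φ hφ z}) hv]
      refine lintegral_congr fun w => ?_
      rw [Set.indicator_of_mem]
      simpa using hv
    · rw [Set.indicator_of_notMem (s := {z | 0 < ringRatio π q Q φ hφ z}) hv]
      rw [← lintegral_zero]
      refine lintegral_congr fun w => ?_
      rw [Set.indicator_of_notMem]
      simpa using hv
  · refine lintegral_congr fun x => ?_
    rw [Kernel.lintegral_compProd q _ x
      (f := fun z : X × U => ringRatio π q Q φ hφ (x, z) * K (x, z))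
      ((hr.mul hK).comp measurable_prodMk_left)]
    refine lintegral_congr fun y => ?_
    have hrk : Measurable fun u : Fin (n + 1) → U => ringRatio π q Q φ hφ (x, (y, u k)) :=
      hr.comp (by fun_prop)
    have hHxy : Measurable fun u : Fin (n + 1) → U => H ((x, y), u) :=
      hH.comp measurable_prodMk_left
    rw [lintegral_pi_insertNth (fun _ => Q (x, y)) k
      (F := fun u => ringRatio π q Q φ hφ (x, (y, u k)) * H ((x, y), u)) (hrk.mul hHxy)]
    refine lintegral_congr fun v => ?_
    simp only [Fin.insertNth_apply_same]
    exact lintegral_const_mul _ (hHxy.comp (hins.comp measurable_prodMk_left))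

lemma lintegral_indexKernel_one {A : Type*} [MeasurableSpace A] (N : ℕ) [NeZero N] (a : A)
    (G : Fin N → ℝ≥0∞) :
    ∫⁻ k, G k ∂(indexKernel (fun (_ : Fin N) (_ : A) => 1) (fun _ => measurable_const) a)
      = ∑ k, (N : ℝ≥0∞)⁻¹ * G k := by
  change ∫⁻ k, G k ∂(∑ k, weightProb (fun _ : Fin N => 1) k • Measure.dirac k) = _
  rw [lintegral_finsetSum_measure]
  refine Finset.sum_congr rfl fun k _ => ?_
  rw [lintegral_smul_measure, lintegral_dirac, smul_eq_mul]
  congr 1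
  simp [weightProb]

/-- The accepted moves of the second mechanism are those of the first, reversed. -/
lemma lintegral_proposal₂ (N : ℕ) [NeZero N] {F : X × X → ℝ≥0∞} (hF : Measurable F) :
    ∫⁻ x, ∫⁻ z, min 1 (ratio₂ π q Q φ hφ N (x, z)) * F (x, z.1) ∂(proposal₂ q Q φ hφ N x) ∂π
      = ∫⁻ p, avgAccProb π q Q φ hφ N p * F p.swap ∂(π ⊗ₘ q) := by
  have hA := measurable_avgRatio_prod π q Q φ hφ N
  have hr := measurable_ringRatio π q Q φ hφ
  let H : (X × X) × (Fin N → U) → ℝ≥0∞ := fun p =>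
    (N : ℝ≥0∞)⁻¹ * (min 1 (avgRatio π q Q φ hφ N p.1.1 p.1.2 p.2)⁻¹ * F p.1.swap)
  have hH : Measurable H :=
    measurable_const.mul ((measurable_const.min hA.inv).mul (by fun_prop))
  have hm : Measurable fun p : X × (X × (Fin N × (Fin N → U))) =>
      min 1 (ratio₂ π q Q φ hφ N p) * F (p.1, p.2.1) :=
    (measurable_const.min (measurable_ratio₂ π q Q φ hφ N)).mul (by fun_prop)
  -- The contributions of the index `k` before and after the change of measure.
  let J : Fin N → X × X → ℝ≥0∞ := fun k p => ∫⁻ u,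
    {u : Fin N → U | 0 < ringRatio π q Q φ hφ (p.2, (p.1, u k))}.indicator
      (fun u => H ((p.2, p.1), u)) u ∂(Measure.pi fun i => aux₂Coord Q φ hφ k i p)
  let R : Fin N → X × X → ℝ≥0∞ := fun k p => ∫⁻ u,
    ringRatio π q Q φ hφ (p.1, (p.2, u k)) * H (p, u) ∂(Measure.pi fun _ : Fin N => Q p)
  have hJR : ∀ k, ∫⁻ x, ∫⁻ y, J k (x, y) ∂(q x) ∂π = ∫⁻ x, ∫⁻ y, R k (x, y) ∂(q x) ∂π :=
    fun k => lintegral_aux₂Coord π q Q φ hφ k hH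
  have hrk : ∀ k : Fin N, Measurable fun p : (X × X) × (Fin N → U) =>
      ringRatio π q Q φ hφ (p.1.1, (p.1.2, p.2 k)) * H p := fun k =>
    (hr.comp (by fun_prop)).mul hH
  have hJ : ∀ k, Measurable (J k) := fun k =>
    Measurable.lintegral_kernel_prod_right' (κ := piKernel (aux₂Coord Q φ hφ k))
      (f := fun p : (X × X) × (Fin N → U) =>
        {u : Fin N → U | 0 < ringRatio π q Q φ hφ (p.1.2, (p.1.1, u k))}.indicator
          (fun u => H ((p.1.2, p.1.1), u)) p.2)
      ((hH.comp (f := fun p : (X × X) × (Fin N → U) => ((p.1.2, p.1.1), p.2))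
        (by fun_prop)).indicator (s := {p : (X × X) × (Fin N → U) |
          0 < ringRatio π q Q φ hφ (p.1.2, (p.1.1, p.2 k))})
        (measurableSet_lt measurable_const (hr.comp (by fun_prop))))
  have hR : ∀ k, Measurable (R k) := fun k =>
    Measurable.lintegral_kernel_prod_right' (κ := piKernel fun _ : Fin N => Q) (hrk k)
  have e1 : ∀ x, ∫⁻ z, min 1 (ratio₂ π q Q φ hφ N (x, z)) * F (x, z.1)
        ∂(proposal₂ q Q φ hφ N x)
      = ∑ k, ∫⁻ y, J k (x, y) ∂(q x) := by
    intro x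
    rw [proposal₂, Kernel.lintegral_compProd _ _ x
      (f := fun z => min 1 (ratio₂ π q Q φ hφ N (x, z)) * F (x, z.1))
      (hm.comp measurable_prodMk_left),
      ← lintegral_finsetSum Finset.univ (f := fun k y => J k (x, y))
        fun k _ => (hJ k).comp measurable_prodMk_left]
    refine lintegral_congr fun y => ?_
    rw [Kernel.lintegral_compProd _ _ (x, y)
      (f := fun z => min 1 (ratio₂ π q Q φ hφ N (x, (y, z))) * F (x, y))
      (hm.comp (f := fun z => (x, (y, z))) (by fun_prop)), lintegral_indexKernel_one]
    refine Finset.sum_congr rfl fun k _ => ?_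
    have hmk : Measurable fun u => min 1 (ratio₂ π q Q φ hφ N (x, (y, (k, u)))) * F (x, y) :=
      hm.comp (f := fun u => (x, (y, (k, u)))) (by fun_prop)
    rw [← lintegral_const_mul _ hmk]
    refine lintegral_congr fun u => ?_
    by_cases hu : 0 < ringRatio π q Q φ hφ (y, (x, u k))
    · have h : ratio₂ π q Q φ hφ N (x, (y, (k, u))) = (avgRatio π q Q φ hφ N y x u)⁻¹ :=
        Set.indicator_of_mem (s := {p : X × (X × (Fin N × (Fin N → U))) |
          0 < ringRatio π q Q φ hφ (p.2.1, (p.1, p.2.2.2 p.2.2.1))}) hu _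
      rw [Set.indicator_of_mem (s := {u : Fin N → U |
        0 < ringRatio π q Q φ hφ (y, (x, u k))}) hu, h]
      rfl
    · have h : ratio₂ π q Q φ hφ N (x, (y, (k, u))) = 0 :=
        Set.indicator_of_notMem (s := {p : X × (X × (Fin N × (Fin N → U))) |
          0 < ringRatio π q Q φ hφ (p.2.1, (p.1, p.2.2.2 p.2.2.1))}) hu _
      rw [Set.indicator_of_notMem (s := {u : Fin N → U |
        0 < ringRatio π q Q φ hφ (y, (x, u k))}) hu, h]
      simp
  simp only [e1]
  rw [lintegral_finsetSum Finset.univ (f := fun k x => ∫⁻ y, J k (x, y) ∂(q x))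
    fun k _ => (hJ k).lintegral_kernel_prod_right']
  simp only [hJR]
  rw [← lintegral_finsetSum Finset.univ (f := fun k x => ∫⁻ y, R k (x, y) ∂(q x))
    fun k _ => (hR k).lintegral_kernel_prod_right',
    Measure.lintegral_compProd (f := fun p => avgAccProb π q Q φ hφ N p * F p.swap)
      ((measurable_avgAccProb π q Q φ hφ N).mul (by fun_prop))]
  refine lintegral_congr_ae ?_
  filter_upwards [ae_avgRatio_lt_top π q Q φ hφ N] with x hx
  rw [← lintegral_finsetSum Finset.univ (f := fun k y => R k (x, y))
    fun k _ => (hR k).comp measurable_prodMk_left]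
  refine lintegral_congr_ae ?_
  filter_upwards [hx] with y hy
  rw [← lintegral_finsetSum Finset.univ
      (f := fun k u => ringRatio π q Q φ hφ (x, (y, u k)) * H ((x, y), u))
      fun k _ => (hrk k).comp (measurable_prodMk_left (x := (x, y))),
    avgAccProb, ← lintegral_mul_const _
      (measurable_const.min (measurable_avgRatio_right π q Q φ hφ N x y))]
  refine lintegral_congr_ae ?_
  filter_upwards [hy] with u hu
  -- Summing the weights `r̊_{u k} / N` gives `r̊ * min 1 r̊⁻¹ = min 1 r̊`.
  rw [← Finset.sum_mul]
  change _ * ((N : ℝ≥0∞)⁻¹ * (min 1 (avgRatio π q Q φ hφ N x y u)⁻¹ * F (y, x))) = _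
  rw [← mul_assoc, ← div_eq_mul_inv]
  change avgRatio π q Q φ hφ N x y u * _ = _
  rw [← mul_assoc]
  congr 1
  rcases eq_or_ne (avgRatio π q Q φ hφ N x y u) 0 with h0 | h0
  · simp [h0]
  · rw [mul_min, mul_one, ENNReal.mul_inv_cancel h0 hu.ne, min_comm]

/-! ### Reversibility and Dirichlet form -/

/-- Apart from a diagonal part, the joint law `π ⊗ P̊^N` is the symmetrization of the law of the
accepted moves of the first mechanism. -/
lemma lintegral_compProd_mhaarKernel (N : ℕ) [NeZero N] : ∃ c : X → ℝ≥0∞,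
    ∀ F : X × X → ℝ≥0∞, Measurable F →
      ∫⁻ p, F p ∂(π ⊗ₘ mhaarKernel π q Q φ hφ N)
        = 2⁻¹ * (∫⁻ p, avgAccProb π q Q φ hφ N p * F p ∂(π ⊗ₘ q)
            + ∫⁻ p, avgAccProb π q Q φ hφ N p * F p.swap ∂(π ⊗ₘ q))
          + ∫⁻ x, c x * F (x, x) ∂π := by
  refine ⟨fun x => 2⁻¹ * (1 - accProb (proposal₁ π q Q φ hφ N) (ratio₁ π q Q φ hφ N) x)
    + 2⁻¹ * (1 - accProb (proposal₂ q Q φ hφ N) (ratio₂ π q Q φ hφ N) x), fun F hF => ?_⟩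
  have hd : Measurable fun x => F (x, x) := by fun_prop
  have h₁ : Measurable fun x => (1 - accProb (proposal₁ π q Q φ hφ N)
      (ratio₁ π q Q φ hφ N) x) * F (x, x) :=
    (measurable_const.sub (measurable_accProb _ (measurable_ratio₁ π q Q φ hφ N))).mul hd
  have h₂ : Measurable fun x => (1 - accProb (proposal₂ q Q φ hφ N)
      (ratio₂ π q Q φ hφ N) x) * F (x, x) :=
    (measurable_const.sub (measurable_accProb _ (measurable_ratio₂ π q Q φ hφ N))).mul hd
  rw [mhaarKernel, lintegral_compProd_halfMix _ _ hF,
    lintegral_compProd_acceptReject _ measurable_fst (measurable_ratio₁ π q Q φ hφ N) hF,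
    lintegral_compProd_acceptReject _ measurable_fst (measurable_ratio₂ π q Q φ hφ N) hF,
    lintegral_proposal₁ π q Q φ hφ N hF, lintegral_proposal₂ π q Q φ hφ N hF]
  simp only [add_mul, mul_assoc]
  rw [lintegral_add_left (h₁.const_mul _), lintegral_const_mul _ h₁, lintegral_const_mul _ h₂]
  ring

lemma mhaarKernel_isReversible (N : ℕ) [NeZero N] :
    (mhaarKernel π q Q φ hφ N).IsReversible π := by
  obtain ⟨c, hc⟩ := lintegral_compProd_mhaarKernel π q Q φ hφ N
  refine isReversible_of_lintegral_swap fun F hF => ?_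
  rw [hc (fun p => F p.swap) (hF.comp measurable_swap), hc F hF]
  simp [add_comm]

lemma dirichletForm_mhaarKernel (N : ℕ) [NeZero N] {f : X → ℝ} (hf : Measurable f) :
    dirichletForm π (mhaarKernel π q Q φ hφ N) f
      = 2⁻¹ * ∫⁻ p, avgAccProb π q Q φ hφ N p * ENNReal.ofReal ((f p.1 - f p.2) ^ 2)
          ∂(π ⊗ₘ q) := by
  obtain ⟨c, hc⟩ := lintegral_compProd_mhaarKernel π q Q φ hφ N
  have hs : ∀ p : X × X, (f p.2 - f p.1) ^ 2 = (f p.1 - f p.2) ^ 2 := fun p => by ring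
  rw [dirichletForm, hc _ (by fun_prop)]
  simp only [Prod.fst_swap, Prod.snd_swap, hs, sub_self, ne_eq, OfNat.ofNat_ne_zero,
    not_false_eq_true, zero_pow, ENNReal.ofReal_zero, mul_zero, lintegral_zero, add_zero]
  rw [← two_mul, ← mul_assoc 2⁻¹ 2, ENNReal.inv_mul_cancel two_ne_zero ENNReal.ofNat_ne_top,
    one_mul]

lemma dirichletForm_mhaarKernel_mono {N M : ℕ} [NeZero N] [NeZero M] (hNM : N ≤ M) {f : X → ℝ}
    (hf : MemLp f 2 π) : dirichletForm π (mhaarKernel π q Q φ hφ N) f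
      ≤ dirichletForm π (mhaarKernel π q Q φ hφ M) f := by
  have hfm := hf.1.stronglyMeasurable_mk.measurable
  rw [dirichletForm_congr_ae (mhaarKernel_isReversible π q Q φ hφ N) hf.1.ae_eq_mk,
    dirichletForm_congr_ae (mhaarKernel_isReversible π q Q φ hφ M) hf.1.ae_eq_mk,
    dirichletForm_mhaarKernel π q Q φ hφ N hfm, dirichletForm_mhaarKernel π q Q φ hφ M hfm]
  gcongr with p
  exact avgAccProb_mono π q Q φ hφ (NeZero.ne N) hNM p

lemma dirichletForm_mhaarKernel_le_mhKernel (N : ℕ) [NeZero N] {f : X → ℝ}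
    (hf : MemLp f 2 π) : dirichletForm π (mhaarKernel π q Q φ hφ N) f
      ≤ dirichletForm π (mhKernel π q) f := by
  have hfm := hf.1.stronglyMeasurable_mk.measurable
  rw [dirichletForm_congr_ae (mhaarKernel_isReversible π q Q φ hφ N) hf.1.ae_eq_mk,
    dirichletForm_congr_ae (mhKernel_isReversible π q) hf.1.ae_eq_mk,
    dirichletForm_mhaarKernel π q Q φ hφ N hfm, dirichletForm_mhKernel π q hfm]
  refine mul_le_mul_right (lintegral_mono_ae ?_) _
  filter_upwards [avgAccProb_le_mhRatio π q Q φ hφ (NeZero.ne N)] with p hp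
  gcongr

end Averaging

end MHAAR

theorem theorem1 {X U : Type*} [MeasurableSpace X] [MeasurableSpace U]
    (π : Measure X) [IsProbabilityMeasure π]
    (q : Kernel X X) [IsMarkovKernel q]
    (Q : Kernel (X × X) U) [IsMarkovKernel Q]
    (φ : U → U) (hφ : Measurable φ) (hφ_inv : Function.Involutive φ) :
    -- reversibility
    (∀ N : ℕ+, (MHAAR.mhaarKernel π q Q φ hφ N).IsReversible π) ∧
    -- right spectral gap
    (∀ N : ℕ+, MHAAR.rightGap π (MHAAR.mhaarKernel π q Q φ hφ N)
      ≤ MHAAR.rightGap π (MHAAR.mhKernel π q)) ∧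
    (Monotone fun N : ℕ+ => MHAAR.rightGap π (MHAAR.mhaarKernel π q Q φ hφ N)) ∧
    (∀ f : X → ℝ, MemLp f 2 π →
      -- Dirichlet form, and first order auto-covariance
      (Monotone fun N : ℕ+ => MHAAR.dirichletForm π (MHAAR.mhaarKernel π q Q φ hφ N) f) ∧
      (Antitone fun N : ℕ+ => MHAAR.autoCov π (MHAAR.mhaarKernel π q Q φ hφ N) f) ∧
      -- the limits that define the asymptotic variances exist
      (∀ N : ℕ+, Tendsto (MHAAR.scaledVariance π (MHAAR.mhaarKernel π q Q φ hφ N) f) atTop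
        (𝓝 (MHAAR.asymVar π (MHAAR.mhaarKernel π q Q φ hφ N) f))) ∧
      Tendsto (MHAAR.scaledVariance π (MHAAR.mhKernel π q) f) atTop
        (𝓝 (MHAAR.asymVar π (MHAAR.mhKernel π q) f)) ∧
      -- comparison of the asymptotic variances
      (Antitone fun N : ℕ+ => MHAAR.asymVar π (MHAAR.mhaarKernel π q Q φ hφ N) f) ∧
      (∀ N : ℕ+, MHAAR.asymVar π (MHAAR.mhKernel π q) f
        ≤ MHAAR.asymVar π (MHAAR.mhaarKernel π q Q φ hφ N) f)) := by
  have hrev := fun N : ℕ+ => MHAAR.mhaarKernel_isReversible π q Q φ hφ N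
  have hP := MHAAR.mhKernel_isReversible π q
  have hmono : ∀ {N M : ℕ+}, N ≤ M → ∀ f : X → ℝ, MemLp f 2 π →
      MHAAR.dirichletForm π (MHAAR.mhaarKernel π q Q φ hφ N) f
        ≤ MHAAR.dirichletForm π (MHAAR.mhaarKernel π q Q φ hφ M) f := fun hNM f hf =>
    MHAAR.dirichletForm_mhaarKernel_mono π q Q φ hφ (PNat.coe_le_coe _ _ |>.2 hNM) hf
  have hle : ∀ (N : ℕ+) (f : X → ℝ), MemLp f 2 π →
      MHAAR.dirichletForm π (MHAAR.mhaarKernel π q Q φ hφ N) f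
        ≤ MHAAR.dirichletForm π (MHAAR.mhKernel π q) f := fun N f hf =>
    MHAAR.dirichletForm_mhaarKernel_le_mhKernel π q Q φ hφ N hf
  refine ⟨hrev, fun N => MHAAR.rightGap_le_of_dirichletForm_le (hle N),
    fun N M hNM => MHAAR.rightGap_le_of_dirichletForm_le (hmono hNM),
    fun f hf => ⟨?_, ?_, ?_, ?_, ?_, ?_⟩⟩
  · exact fun N M hNM => hmono hNM f hf
  · exact fun N M hNM => MHAAR.autoCov_le_of_dirichletForm_le (hrev N) (hrev M) (hmono hNM) hf
  · exact fun N => MHAAR.tendsto_scaledVariance (hrev N) hf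
  · exact MHAAR.tendsto_scaledVariance hP hf
  · exact fun N M hNM => MHAAR.asymVar_le_of_dirichletForm_le (hrev N) (hrev M) (hmono hNM) hf
  · exact fun N => MHAAR.asymVar_le_of_dirichletForm_le (hrev N) hP (hle N) hf
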